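/- **Setting.** For $x\in\mathbb R$ and $r>0$, $x^{r}$ denotes the odd power $|x|^{r-1}x$. Fix $\theta\in(0,1)$, $q\in(1,\infty)$ and $q'=q/(q-1)$, a space step $h>0$, an integer $M_x\ge 1$ (so that the domain is $I=(-L,L)$ with $L=(M_x+1)h$), and a sequence $\mathbf u^0\in\mathbb R^{\mathbb Z}$ with $(\mathbf u^0)_i=0$ for $|i|>M_x$. Let $$C_{1,\theta}=\frac{2\theta\,2^{2\theta-1}\Gamma\left(\frac{1+2\theta}{2}\right)}{\pi^{1/2}\,\Gamma\left(\frac{2-2\theta}{2}\right)},\qquad G(t)=\begin{cases}\dfrac{C_{1,\theta}}{(2-2\theta)(2\theta-1)2\theta}|t|^{2-2\theta}, & 2\theta\ne 1,\\ C_{1,\theta}(t-t\log|t|), & 2\theta=1,\end{cases}$$ and define weights $w_{-j}^h=w_j^h$ by $$w_j^h=h^{-2\theta}\begin{cases}\frac{C_{1,\theta}}{2-2\theta}-G''(1)-\frac{G'(3)+3G'(1)}{2}+G(3)-G(1), & j=1,\\ 2\left[G'(j+1)+G'(j-1)-G(j+1)+G(j-1)\right], & j=2,4,6,\dots,\\ -\frac{G'(j+2)+6G'(j)+G'(j-2)}{2}+G(j+2)-G(j-2),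 & j=3,5,7,\dots,\end{cases}$$ with $w_0^h=0$ (its value plays no role). Put $$[(-\Delta)^\theta_h\mathbf f]_i=\sum_{j\in\mathbb Z}w_j^h(f_i-f_{i-j}),\quad \|\mathbf f\|_{\ell^p_h}=\Big(\sum_{i\in\mathbb Z}h|f_i|^p\Big)^{1/p},\quad \|\mathbf f\|_{\mathcal X}=\Big(\frac12\sum_{i,j\in\mathbb Z}h\,w_j^h|f_i-f_{i-j}|^2\Big)^{1/2},$$ and let $\mathcal X$ be the set of sequences that vanish for $|i|>M_x$ and have $\|\mathbf f\|_{\mathcal X}<\infty$. For $\Delta t>0$, a solution of (FD) is a family $(u_i^n)_{n\in\mathbb N,i\in\mathbb Z}$ with $$\frac{(u_i^{n+1})^{q-1}-(u_i^n)^{q-1}}{\Delta t}+[(-\Delta)^\theta_h\mathbf u^{n+1}]_i=0\ \ (|i|\le M_x,\ n\ge0),$$ $u_i^n=0$ for $|i|\ge M_x+1$, $n\ge0$, and $u^0_i=(\mathbf u^0)_i$ for $|i|\le M_x$. A solution of (SD) is a family of continuous functions $v_i:[0,\infty)\to\mathbb R$, $i\in\mathbb Z$, with $v_i^{q-1}\in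 W^{1,1}(0,T)$ for every $T>0$, such that, for $|i|\le M_x$, $$\frac{\mathrm d}{\mathrm dt}v_i^{q-1}(t)+[(-\Delta)^\theta_h\mathbf v(t)]_i=0\quad\text{in the weak sense on }(0,\infty),$$ $v_i(t)=0$ for $|i|\ge M_x+1$, $t\ge0$, and $v_i(0)=(\mathbf u^0)_i$ for $|i|\le M_x$. **Proposition (Existence and stability for (SD)).** Problem (SD) has a unique solution $\mathbf v=(v_i)_{i\in\mathbb Z}$ on $[0,\infty)$, and $\mathbf v(t)\in\mathcal X$ for all $t\ge 0$. For every $i\in\mathbb Z$ and $T>0$: $v_i^{q-1}\in W^{1,1}(0,T)$, $v_i^{q}\in W^{1,1}(0,T)$ and $v_i^{q/2}\in W^{1,2}(0,T)$. Moreover $$\frac1{q'}\frac{\mathrm d}{\mathrm dt}\|\mathbf v(t)\|_{\ell^q_h}^q+\|\mathbf v(t)\|_{\mathcal X}^2=0\quad\text{for a.e. }t\in(0,\infty),$$ $$\frac{4}{qq'}\int_s^t\|\partial_\tau\mathbf v^{q/2}(\tau)\|_{\ell^2_h}^2\,\mathrm d\tau+\frac12\|\mathbf v(t)\|_{\mathcal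 X}^2\le\frac12\|\mathbf v(s)\|_{\mathcal X}^2\quad\text{for all }0\le s<t<\infty,$$ where $\partial_\tau \mathbf v^{q/2}$ is the componentwise weak derivative. Furthermore, for every $\Delta t>0$ problem (FD) has a unique solution $(u_i^n)$; define $v_i^{\Delta t}(t)=u_i^{n+1}$ for $t\in(n\Delta t,(n+1)\Delta t]$, $n\in\mathbb N$, and $v_i^{\Delta t}(0)=u_i^0$. Then, for every $i\in\mathbb Z$ and $T>0$, $v_i^{\Delta t}\to v_i$ uniformly on $[0,T]$ as $\Delta t\to0$. -/

import Mathlib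

open Set Filter Topology MeasureTheory

namespace FracScheme

noncomputable section

/-- The signed (odd) power `x ^ r := |x| ^ (r - 1) * x`. -/
def oddPow (x r : ℝ) : ℝ := |x| ^ (r - 1) * x

/-- The normalising constant `C_{1,θ}` of the one-dimensional fractional Laplacian of order `2θ`. -/
def fracConst (θ : ℝ) : ℝ :=
  2 * θ * (2 : ℝ) ^ (2 * θ - 1) * Real.Gamma ((1 + 2 * θ) / 2) /
    (Real.pi ^ ((1 : ℝ) / 2) * Real.Gamma ((2 - 2 * θ) / 2))

/-- The function `G` of the Huang-Oberman quadrature. -/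
def auxG (θ t : ℝ) : ℝ :=
  if 2 * θ = 1 then fracConst θ * (t - t * Real.log |t|)
  else fracConst θ / ((2 - 2 * θ) * (2 * θ - 1) * (2 * θ)) * |t| ^ (2 - 2 * θ)

/-- The Huang-Oberman weights `h ^ (2θ) * w_n` for a nonnegative index `n`.
The weight of index `0` always multiplies `f_i - f_i = 0`; it is set to zero. -/
def weightAux (θ : ℝ) (n : ℕ) : ℝ :=
  if n = 0 then 0
  else if n = 1 then
    fracConst θ / (2 - 2 * θ) - deriv (deriv (auxG θ)) 1
      - (deriv (auxG θ) 3 + 3 * deriv (auxG θ) 1) / 2 + auxG θ 3 - auxG θ 1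
  else if Even n then
    2 * (deriv (auxG θ) ((n : ℝ) + 1) + deriv (auxG θ) ((n : ℝ) - 1)
      - auxG θ ((n : ℝ) + 1) + auxG θ ((n : ℝ) - 1))
  else
    -(deriv (auxG θ) ((n : ℝ) + 2) + 6 * deriv (auxG θ) (n : ℝ)
        + deriv (auxG θ) ((n : ℝ) - 2)) / 2
      + auxG θ ((n : ℝ) + 2) - auxG θ ((n : ℝ) - 2)

/-- The symmetric weights `w_j^h(θ)`, `j ∈ ℤ`. -/
def weight (θ h : ℝ) (j : ℤ) : ℝ := h ^ (-(2 * θ)) * weightAux θ j.natAbs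

/-- The discrete fractional Laplacian `[(-Δ)_h^θ f]_i = ∑_j w_j (f_i - f_{i-j})`. -/
def fracLap (θ h : ℝ) (f : ℤ → ℝ) (i : ℤ) : ℝ :=
  ∑' j : ℤ, weight θ h j * (f i - f (i - j))

/-- The norm of the discrete Lebesgue space `ℓ^p_h`. -/
def lNorm (h p : ℝ) (f : ℤ → ℝ) : ℝ := (∑' i : ℤ, h * |f i| ^ p) ^ (1 / p)

/-- The discrete Gagliardo seminorm `(1/2 ∑_{i,j} h w_j |f_i - f_{i-j}|^2)^{1/2}`; it is the norm of
the space `discreteX`. -/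
def xNorm (θ h : ℝ) (f : ℤ → ℝ) : ℝ :=
  Real.sqrt (1 / 2 * ∑' p : ℤ × ℤ, h * weight θ h p.2 * |f p.1 - f (p.1 - p.2)| ^ 2)

/-- Sequences vanishing for `|i| > M` whose discrete Gagliardo seminorm is finite. -/
def discreteX (θ h : ℝ) (M : ℕ) : Set (ℤ → ℝ) :=
  {f | (∀ i : ℤ, (M : ℤ) < |i| → f i = 0) ∧
    Summable fun p : ℤ × ℤ => h * weight θ h p.2 * |f p.1 - f (p.1 - p.2)| ^ 2}

/-- `g` is the weak derivative of `f` on the interval `(0, T)`. -/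
def HasWeakDeriv (T : ℝ) (f g : ℝ → ℝ) : Prop :=
  LocallyIntegrableOn f (Ioo 0 T) ∧ LocallyIntegrableOn g (Ioo 0 T) ∧
    ∀ φ : ℝ → ℝ, ContDiff ℝ ((⊤ : ℕ∞) : WithTop ℕ∞) φ → HasCompactSupport φ →
      tsupport φ ⊆ Ioo 0 T →
        ∫ t in Ioo 0 T, f t * deriv φ t = -∫ t in Ioo 0 T, g t * φ t

/-- `f` belongs to the Sobolev space `W^{1,p}(0, T; ℝ)`. -/
def MemW1 (p : ENNReal) (T : ℝ) (f : ℝ → ℝ) : Prop :=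
  MemLp f p (volume.restrict (Ioo 0 T)) ∧
    ∃ g : ℝ → ℝ, MemLp g p (volume.restrict (Ioo 0 T)) ∧ HasWeakDeriv T f g

/-- `u n i = u_i^n` solves the fully discrete (implicit Euler) scheme with time step `dt` and
initial datum `u0`. -/
structure IsFDSolution (θ h q : ℝ) (M : ℕ) (u0 : ℤ → ℝ) (dt : ℝ) (u : ℕ → ℤ → ℝ) : Prop where
  equation : ∀ (n : ℕ) (i : ℤ), |i| ≤ (M : ℤ) →
    (oddPow (u (n + 1) i) (q - 1) - oddPow (u n i) (q - 1)) / dt + fracLap θ h (u (n + 1)) i = 0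
  boundary : ∀ (n : ℕ) (i : ℤ), (M : ℤ) + 1 ≤ |i| → u n i = 0
  initial : ∀ i : ℤ, |i| ≤ (M : ℤ) → u 0 i = u0 i

/-- `v t i = v_i(t)`, `t ≥ 0`, solves the semi-discrete scheme with initial datum `u0`. Each `v_i` is
represented by a continuous function, so that `v_i(0)` is meaningful; `v_i^{q-1} ∈ W^{1,1}(0, T)` for
all `T > 0`, and its weak time derivative is `-[(-Δ)_h^θ v]_i` for `|i| ≤ M`. Only the values at
`t ≥ 0` matter. -/
structure IsSDSolution (θ h q : ℝ) (M : ℕ) (u0 : ℤ → ℝ) (v : ℝ → ℤ → ℝ) : Prop where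
  continuousOn : ∀ i : ℤ, ContinuousOn (fun t => v t i) (Ici 0)
  sobolev : ∀ (i : ℤ) (T : ℝ), 0 < T → MemW1 1 T (fun t => oddPow (v t i) (q - 1))
  equation : ∀ i : ℤ, |i| ≤ (M : ℤ) → ∀ T : ℝ, 0 < T →
    HasWeakDeriv T (fun t => oddPow (v t i) (q - 1)) (fun t => -fracLap θ h (v t) i)
  boundary : ∀ i : ℤ, (M : ℤ) + 1 ≤ |i| → ∀ t : ℝ, 0 ≤ t → v t i = 0
  initial : ∀ i : ℤ, |i| ≤ (M : ℤ) → v 0 i = u0 i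

/-- The piecewise constant interpolant in time: it equals `u (n + 1)` on `(n dt, (n + 1) dt]`, and
`u 0` at time `0`. -/
def interpolant (dt : ℝ) (u : ℕ → ℤ → ℝ) (t : ℝ) (i : ℤ) : ℝ := u ⌈t / dt⌉₊ i

end

end FracScheme

namespace FracScheme

/-! ### Odd powers -/

/-! Sequences live on the finitely many nodes |i| ≤ M, so both schemes discretise or state one
system d/dt x^(q-1) + A x = 0, with odd powers taken componentwise and A = `lap`. The evolution
argument uses only that A is symmetric and positive semidefinite (`IsPSD`). Positivity holds because
the Gagliardo double sum equals 2h⟨Ax, x⟩ (`hasSum_gagliardo`) and the weights are nonnegative.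

Sign of the weights: G is a triple primitive of the kernel K(t) = C t^(-1-2θ), so each weight is an
integral of K against a piecewise quadratic nodal function, plus a positive term when j = 1. For
even j this function is nonnegative. For odd j ≥ 3 it changes sign, and K is replaced by its
interpolant α t^(-3) + β at the sign changes, for which the integral is explicit
(`exists_kernel_interpolation`, `log_node_inequality`).

Existence, uniqueness and convergence: an implicit Euler step is the critical point equation of a
coercive functional. Testing the difference of two integrated equations with v₁ - v₂ uses only
monotonicity of the power and the identity 2⟨AF, F'⟩ = d/dt ⟨AF, F⟩; no Gronwall argument or
Lipschitz bound enters. The resulting `IsApprox.exists_abs_sub_le` makes the Euler interpolants,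
whose error is O(dt), a Cauchy family. Their limit solves the integrated equation (`IsExact`), and
error zero gives uniqueness.

Energy: the Stroock-Varopoulos inequality and convexity of ⟨Ax, x⟩ give a dissipation estimate per
step. Cauchy-Schwarz over many steps and the limit dt → 0 give c ∑ |w(t) - w(s)|² ≤ (t - s)(E(s) -
E(t)), where w = v^(q/2) and E = ⟨Av, v⟩/2 (`IsExact.energy_le`). Such increments force w to be
absolutely continuous with c ∑ |w'|² ≤ -E' almost everywhere, and the integral of -E' is at most the
drop of E. This handles v^(q/2), which for q > 2 is not a C¹ function of v^(q-1); the powers v^q and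
|v|^q are, and follow from the chain rule. -/

@[simp] lemma oddPow_zero (r : ℝ) : oddPow 0 r = 0 := by simp [oddPow]

lemma oddPow_neg (x r : ℝ) : oddPow (-x) r = -oddPow x r := by simp [oddPow]

@[simp] lemma oddPow_one (x : ℝ) : oddPow x 1 = x := by simp [oddPow]

lemma oddPow_of_nonneg {x r : ℝ} (hx : 0 ≤ x) (hr : 0 < r) : oddPow x r = x ^ r := by
  rcases hx.eq_or_lt with rfl | hx
  · simp [hr.ne']
  · rw [oddPow, abs_of_pos hx, Real.rpow_sub_one hx.ne', div_mul_cancel₀ _ hx.ne']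

/-- For r < 1 the factor |x|^(r-1) is singular at 0, whereas both truncated powers are continuous
for every r > 0. -/
lemma oddPow_eq_max {r : ℝ} (hr : 0 < r) (x : ℝ) :
    oddPow x r = (max x 0) ^ r - (max (-x) 0) ^ r := by
  rcases le_total 0 x with hx | hx
  · rw [oddPow_of_nonneg hx hr, max_eq_left hx, max_eq_right (by linarith),
      Real.zero_rpow hr.ne', sub_zero]
  · rw [← neg_neg x, oddPow_neg, oddPow_of_nonneg (by linarith) hr, neg_neg,
      max_eq_right hx, max_eq_left (by linarith), Real.zero_rpow hr.ne', zero_sub]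

lemma continuous_oddPow {r : ℝ} (hr : 0 < r) : Continuous fun x => oddPow x r := by
  simp_rw [oddPow_eq_max hr]
  exact ((continuous_id.max continuous_const).rpow_const fun _ => Or.inr hr.le).sub
    ((continuous_neg.max continuous_const).rpow_const fun _ => Or.inr hr.le)

lemma abs_oddPow {r : ℝ} (hr : 0 < r) (x : ℝ) : |oddPow x r| = |x| ^ r := by
  rw [← oddPow_of_nonneg (abs_nonneg x) hr, oddPow, oddPow, abs_mul, abs_abs,
    abs_of_nonneg (Real.rpow_nonneg (abs_nonneg x) _)]

/-- With s = 1/r this inverts the power, which is how v is recovered from v^(q-1). -/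
lemma oddPow_oddPow {r s : ℝ} (hr : 0 < r) (hs : 0 < s) (x : ℝ) :
    oddPow (oddPow x r) s = oddPow x (r * s) := by
  have key : ∀ y : ℝ, 0 ≤ y → oddPow (oddPow y r) s = oddPow y (r * s) := fun y hy => by
    rw [oddPow_of_nonneg hy hr, oddPow_of_nonneg (Real.rpow_nonneg hy r) hs,
      oddPow_of_nonneg hy (mul_pos hr hs), Real.rpow_mul hy]
  rcases le_total 0 x with hx | hx
  · exact key x hx
  · have := key (-x) (by linarith)
    simpa only [oddPow_neg, neg_inj] using this

lemma strictMono_oddPow {r : ℝ} (hr : 0 < r) : StrictMono fun x => oddPow x r := by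
  have hpos : StrictMonoOn (fun x => oddPow x r) (Ici 0) := fun a ha b hb hab => by
    simp only [oddPow_of_nonneg ha hr, oddPow_of_nonneg hb hr]
    exact Real.rpow_lt_rpow ha hab hr
  have hneg : StrictMonoOn (fun x => oddPow x r) (Iic 0) := fun a ha b hb hab => by
    have := hpos (a := -b) (by simpa using hb) (b := -a) (by simpa using ha) (by linarith)
    simp only [oddPow_neg] at this
    simpa using this
  exact hneg.Iic_union_Ici hpos

lemma oddPow_sub_mul_sub_nonneg {r : ℝ} (hr : 0 < r) (a b : ℝ) :
    0 ≤ (oddPow a r - oddPow b r) * (a - b) := by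
  rcases le_total a b with h | h
  · exact mul_nonneg_of_nonpos_of_nonpos
      (sub_nonpos.2 ((strictMono_oddPow hr).monotone h)) (sub_nonpos.2 h)
  · exact mul_nonneg (sub_nonneg.2 ((strictMono_oddPow hr).monotone h)) (sub_nonneg.2 h)

lemma eq_of_oddPow_sub_mul_sub_eq_zero {r : ℝ} (hr : 0 < r) {a b : ℝ}
    (h : (oddPow a r - oddPow b r) * (a - b) = 0) : a = b := by
  rcases mul_eq_zero.1 h with h | h
  · exact (strictMono_oddPow hr).injective (sub_eq_zero.1 h)
  · exact sub_eq_zero.1 h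

lemma hasDerivAt_oddPow_of_ne (r : ℝ) {x : ℝ} (hx : x ≠ 0) :
    HasDerivAt (fun y => oddPow y r) (r * |x| ^ (r - 1)) x := by
  have key : ∀ z : ℝ, 0 < z → HasDerivAt (fun y => oddPow y r) (r * |z| ^ (r - 1)) z :=
    fun z hz => by
      rw [abs_of_pos hz]
      refine (Real.hasDerivAt_rpow_const (p := r) (Or.inl hz.ne')).congr_of_eventuallyEq ?_
      filter_upwards [eventually_gt_nhds hz] with y hy
      rw [oddPow, abs_of_pos hy, Real.rpow_sub_one hy.ne', div_mul_cancel₀ _ hy.ne']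
  rcases hx.lt_or_gt with hx | hx
  · have h := ((key (-x) (by linarith)).comp x (hasDerivAt_neg x)).neg
    refine (h.congr_deriv (by simp)).congr_of_eventuallyEq (Eventually.of_forall fun y => ?_)
    simp [oddPow_neg]
  · exact key x hx

lemma hasDerivAt_oddPow {r : ℝ} (hr : 1 < r) (x : ℝ) :
    HasDerivAt (fun y => oddPow y r) (r * |x| ^ (r - 1)) x := by
  rcases eq_or_ne x 0 with rfl | hx
  · rw [abs_zero, Real.zero_rpow (by linarith), mul_zero, hasDerivAt_iff_tendsto_slope]
    have h : Tendsto (fun y : ℝ => |y| ^ (r - 1)) (𝓝[≠] 0) (𝓝 0) := by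
      have : Continuous fun y : ℝ => |y| ^ (r - 1) :=
        continuous_abs.rpow_const fun _ => Or.inr (by linarith)
      have h0 := this.tendsto 0
      rw [abs_zero, Real.zero_rpow (by linarith)] at h0
      exact h0.mono_left nhdsWithin_le_nhds
    refine h.congr' ?_
    filter_upwards [self_mem_nhdsWithin] with y hy
    have hy : y ≠ 0 := hy
    simp [slope_def_field, oddPow, hy]
  · exact hasDerivAt_oddPow_of_ne r hx

lemma hasDerivAt_abs_rpow_div {q : ℝ} (hq : 1 < q) (x : ℝ) :
    HasDerivAt (fun y : ℝ => |y| ^ q / q) (oddPow x (q - 1)) x := by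
  refine ((hasDerivAt_abs_rpow x hq).div_const q).congr_deriv ?_
  rw [oddPow, show q - 1 - 1 = q - 2 by ring]
  field_simp

/-- The Stroock-Varopoulos inequality. -/
lemma sq_oddPow_half_sub_le {q : ℝ} (hq : 1 < q) (a b : ℝ) :
    4 / (q * Real.conjExponent q) * (oddPow a (q / 2) - oddPow b (q / 2)) ^ 2 ≤
      (oddPow a (q - 1) - oddPow b (q - 1)) * (a - b) := by
  wlog hab : b < a generalizing a b
  · rcases (not_lt.1 hab).eq_or_lt with rfl | h
    · simp
    · have := this b a h
      nlinarith [this]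
  have hq0 : 0 < q := by linarith
  have hq1 : 0 < q - 1 := by linarith
  -- Off 0 the derivative is the square (|x|^(q/2-1) - l)². Monotonicity for all l is Cauchy-Schwarz
  -- in disguise, without integrating the power |x|^(q-2), singular at 0 for q < 2.
  have hmono : ∀ l : ℝ, Monotone fun x : ℝ =>
      oddPow x (q - 1) / (q - 1) - 2 * l * (oddPow x (q / 2) / (q / 2)) + l ^ 2 * x := by
    intro l
    have hc : Continuous fun x : ℝ =>
        oddPow x (q - 1) / (q - 1) - 2 * l * (oddPow x (q / 2) / (q / 2)) + l ^ 2 * x :=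
      (((continuous_oddPow hq1).div_const _).sub
        (((continuous_oddPow (half_pos hq0)).div_const _).const_mul _)).add
        (continuous_const.mul continuous_id)
    have hd : ∀ x : ℝ, x ≠ 0 → HasDerivAt (fun x : ℝ =>
        oddPow x (q - 1) / (q - 1) - 2 * l * (oddPow x (q / 2) / (q / 2)) + l ^ 2 * x)
        ((|x| ^ (q / 2 - 1) - l) ^ 2) x := by
      intro x hx
      refine ((((hasDerivAt_oddPow_of_ne (q - 1) hx).div_const (q - 1)).sub
        (((hasDerivAt_oddPow_of_ne (q / 2) hx).div_const (q / 2)).const_mul (2 * l))).add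
        ((hasDerivAt_id x).const_mul (l ^ 2))).congr_deriv ?_
      have h2 : |x| ^ (q - 1 - 1) = (|x| ^ (q / 2 - 1)) ^ 2 := by
        rw [← Real.rpow_natCast, ← Real.rpow_mul (abs_nonneg x)]
        congr 1; push_cast; ring
      rw [h2]
      field_simp
      ring
    have h1 : MonotoneOn (fun x : ℝ =>
        oddPow x (q - 1) / (q - 1) - 2 * l * (oddPow x (q / 2) / (q / 2)) + l ^ 2 * x) (Ici 0) := by
      refine monotoneOn_of_deriv_nonneg (convex_Ici 0) hc.continuousOn ?_ ?_ <;>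
        rw [interior_Ici] <;> intro x hx
      · exact (hd x (ne_of_gt hx)).differentiableAt.differentiableWithinAt
      · rw [(hd x (ne_of_gt hx)).deriv]; positivity
    have h2 : MonotoneOn (fun x : ℝ =>
        oddPow x (q - 1) / (q - 1) - 2 * l * (oddPow x (q / 2) / (q / 2)) + l ^ 2 * x) (Iic 0) := by
      refine monotoneOn_of_deriv_nonneg (convex_Iic 0) hc.continuousOn ?_ ?_ <;>
        rw [interior_Iic] <;> intro x hx
      · exact (hd x (ne_of_lt hx)).differentiableAt.differentiableWithinAt
      · rw [(hd x (ne_of_lt hx)).deriv]; positivity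
    exact h2.Iic_union_Ici h1
  have hd : 0 < a - b := sub_pos.2 hab
  -- The optimal l is the mean value of |x|^(q/2-1) over [b, a].
  have key := hmono ((oddPow a (q / 2) - oddPow b (q / 2)) / (q / 2) / (a - b)) hab.le
  simp only at key
  generalize oddPow a (q - 1) = A at *
  generalize oddPow b (q - 1) = B at *
  generalize oddPow a (q / 2) = C at *
  generalize oddPow b (q / 2) = D at *
  rw [Real.conjExponent]
  have e : (A - B) / (q - 1) - ((C - D) / (q / 2)) ^ 2 / (a - b) =
      (A / (q - 1) - 2 * ((C - D) / (q / 2) / (a - b)) * (C / (q / 2)) +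
        ((C - D) / (q / 2) / (a - b)) ^ 2 * a) -
      (B / (q - 1) - 2 * ((C - D) / (q / 2) / (a - b)) * (D / (q / 2)) +
        ((C - D) / (q / 2) / (a - b)) ^ 2 * b) := by
    field_simp
    ring
  have h0 : ((C - D) / (q / 2)) ^ 2 / (a - b) ≤ (A - B) / (q - 1) := by linarith
  rw [div_le_div_iff₀ hd hq1] at h0
  calc 4 / (q * (q / (q - 1))) * (C - D) ^ 2 = ((C - D) / (q / 2)) ^ 2 * (q - 1) := by
        field_simp; ring
    _ ≤ _ := h0

/-! ### The Huang-Oberman weights -/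

/-- Repeated integration by parts against a quadratic polynomial. -/
lemma integral_mul_quadratic {G G₁ G₂ K : ℝ → ℝ}
    (h0 : ∀ t, 0 < t → HasDerivAt G (G₁ t) t) (h1 : ∀ t, 0 < t → HasDerivAt G₁ (G₂ t) t)
    (h2 : ∀ t, 0 < t → HasDerivAt G₂ (K t) t) (hK : ContinuousOn K (Ioi 0))
    {a b : ℝ} (ha : 0 < a) (hab : a ≤ b) (A B D : ℝ) :
    ∫ t in a..b, K t * (A + B * t + D * t ^ 2) =
      (G₂ b * (A + B * b + D * b ^ 2) - G₁ b * (B + 2 * D * b) + G b * (2 * D)) -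
      (G₂ a * (A + B * a + D * a ^ 2) - G₁ a * (B + 2 * D * a) + G a * (2 * D)) := by
  have hpos : ∀ t ∈ uIcc a b, 0 < t := fun t ht => by
    rw [uIcc_of_le hab] at ht; exact ha.trans_le ht.1
  refine intervalIntegral.integral_eq_sub_of_hasDerivAt
    (f := fun t => G₂ t * (A + B * t + D * t ^ 2) - G₁ t * (B + 2 * D * t) + G t * (2 * D))
    (fun t ht => ?_) ?_
  · have ht0 := hpos t ht
    have hp : HasDerivAt (fun t : ℝ => A + B * t + D * t ^ 2) (B + 2 * D * t) t := by
      refine ((((hasDerivAt_id t).const_mul B).const_add A).add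
        ((hasDerivAt_pow 2 t).const_mul D)).congr_deriv ?_
      simp; ring
    have hp' : HasDerivAt (fun t : ℝ => B + 2 * D * t) (2 * D) t := by
      simpa using ((hasDerivAt_id t).const_mul (2 * D)).const_add B
    refine ((((h2 t ht0).mul hp).sub ((h1 t ht0).mul hp')).add
      ((h0 t ht0).mul_const (2 * D))).congr_deriv ?_
    ring
  · refine ContinuousOn.intervalIntegrable (ContinuousOn.mul (hK.mono hpos) ?_)
    fun_prop

/-- The integral of `K` against the piecewise quadratic nodal function of an odd node `m`. -/
lemma integral_odd_node {G G₁ G₂ K : ℝ → ℝ}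
    (h0 : ∀ t, 0 < t → HasDerivAt G (G₁ t) t) (h1 : ∀ t, 0 < t → HasDerivAt G₁ (G₂ t) t)
    (h2 : ∀ t, 0 < t → HasDerivAt G₂ (K t) t) (hK : ContinuousOn K (Ioi 0))
    {m : ℝ} (hm : 2 < m) :
    (∫ t in (m - 2)..m, K t * ((t - m + 1) * (t - m + 2) / 2)) +
      (∫ t in m..(m + 2), K t * ((m + 1 - t) * (m + 2 - t) / 2)) =
    -(G₁ (m + 2) + 6 * G₁ m + G₁ (m - 2)) / 2 + G (m + 2) - G (m - 2) := by
  have e1 : (fun t => K t * ((t - m + 1) * (t - m + 2) / 2)) = fun t =>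
      K t * ((m - 1) * (m - 2) / 2 + (3 - 2 * m) / 2 * t + 1 / 2 * t ^ 2) := by
    funext t; ring
  have e2 : (fun t => K t * ((m + 1 - t) * (m + 2 - t) / 2)) = fun t =>
      K t * ((m + 1) * (m + 2) / 2 + (-3 - 2 * m) / 2 * t + 1 / 2 * t ^ 2) := by
    funext t; ring
  rw [e1, e2, integral_mul_quadratic h0 h1 h2 hK (by linarith) (by linarith),
    integral_mul_quadratic h0 h1 h2 hK (by linarith) (by linarith)]
  ring

lemma fracConst_pos {θ : ℝ} (h0 : 0 < θ) (h1 : θ < 1) : 0 < fracConst θ := by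
  have := Real.Gamma_pos_of_pos (s := (1 + 2 * θ) / 2) (by linarith)
  have := Real.Gamma_pos_of_pos (s := (2 - 2 * θ) / 2) (by linarith)
  have := Real.pi_pos
  rw [fracConst]
  positivity

/-- The derivative of `auxG` on the positive half line. -/
noncomputable def auxG' (θ t : ℝ) : ℝ :=
  if 2 * θ = 1 then -fracConst θ * Real.log t
  else fracConst θ / ((2 * θ - 1) * (2 * θ)) * t ^ (1 - 2 * θ)

/-- The second derivative of `auxG` on the positive half line. -/
noncomputable def auxG'' (θ t : ℝ) : ℝ := -(fracConst θ / (2 * θ)) * t ^ (-(2 * θ))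

/-- The kernel of the fractional Laplacian on the positive half line. -/
noncomputable def kernel (θ t : ℝ) : ℝ := fracConst θ * t ^ (-(2 * θ) - 1)

lemma hasDerivAt_auxG {θ : ℝ} (h1 : θ < 1) {t : ℝ} (ht : 0 < t) :
    HasDerivAt (auxG θ) (auxG' θ t) t := by
  by_cases h : 2 * θ = 1
  · rw [auxG', if_pos h]
    have hd : HasDerivAt (fun t : ℝ => fracConst θ * (t - t * Real.log t))
        (-fracConst θ * Real.log t) t := by
      refine (((hasDerivAt_id t).sub
        ((hasDerivAt_id t).mul (Real.hasDerivAt_log ht.ne'))).const_mul _).congr_deriv ?_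
      simp [ht.ne']
    refine hd.congr_of_eventuallyEq (Eventually.of_forall fun x => ?_)
    simp [auxG, h]
  · rw [auxG', if_neg h]
    have hd : HasDerivAt
        (fun t : ℝ => fracConst θ / ((2 - 2 * θ) * (2 * θ - 1) * (2 * θ)) * t ^ (2 - 2 * θ))
        (fracConst θ / ((2 * θ - 1) * (2 * θ)) * t ^ (1 - 2 * θ)) t := by
      refine ((Real.hasDerivAt_rpow_const (p := 2 - 2 * θ)
        (Or.inl ht.ne')).const_mul _).congr_deriv ?_
      rw [show 2 - 2 * θ - 1 = 1 - 2 * θ by ring, ← mul_assoc]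
      congr 1
      have h2 : 1 - θ ≠ 0 := by linarith
      rw [show 2 - 2 * θ = 2 * (1 - θ) by ring]
      field_simp
    refine hd.congr_of_eventuallyEq ?_
    filter_upwards [eventually_gt_nhds ht] with x hx
    rw [auxG, if_neg h, abs_of_pos hx]

lemma hasDerivAt_auxG' {θ : ℝ} (h0 : 0 < θ) {t : ℝ} (ht : 0 < t) :
    HasDerivAt (auxG' θ) (auxG'' θ t) t := by
  by_cases h : 2 * θ = 1
  · have hd : HasDerivAt (fun t => -fracConst θ * Real.log t) (auxG'' θ t) t := by
      refine ((Real.hasDerivAt_log ht.ne').const_mul _).congr_deriv ?_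
      rw [auxG'', h, Real.rpow_neg_one, div_one]
    refine hd.congr_of_eventuallyEq (Eventually.of_forall fun x => ?_)
    simp [auxG', h]
  · have hd : HasDerivAt (fun t : ℝ => fracConst θ / ((2 * θ - 1) * (2 * θ)) * t ^ (1 - 2 * θ))
        (auxG'' θ t) t := by
      refine ((Real.hasDerivAt_rpow_const (p := 1 - 2 * θ)
        (Or.inl ht.ne')).const_mul _).congr_deriv ?_
      rw [auxG'', show 1 - 2 * θ - 1 = -(2 * θ) by ring, ← mul_assoc]
      congr 1
      have h2 : 2 * θ - 1 ≠ 0 := sub_ne_zero.2 h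
      field_simp
      ring
    refine hd.congr_of_eventuallyEq (Eventually.of_forall fun x => ?_)
    simp [auxG', h]

lemma hasDerivAt_auxG'' {θ : ℝ} (h0 : 0 < θ) {t : ℝ} (ht : 0 < t) :
    HasDerivAt (auxG'' θ) (kernel θ t) t := by
  refine ((Real.hasDerivAt_rpow_const (p := -(2 * θ)) (Or.inl ht.ne')).const_mul _).congr_deriv ?_
  rw [kernel]
  field_simp

lemma continuousOn_kernel (θ : ℝ) : ContinuousOn (kernel θ) (Ioi 0) :=
  continuousOn_const.mul (continuousOn_id.rpow_const fun _ hx => Or.inl (ne_of_gt hx))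

lemma kernel_pos {θ : ℝ} (h0 : 0 < θ) (h1 : θ < 1) {t : ℝ} (ht : 0 < t) : 0 < kernel θ t :=
  mul_pos (fracConst_pos h0 h1) (Real.rpow_pos_of_pos ht _)

lemma kernel_le_kernel {θ : ℝ} (h0 : 0 < θ) (h1 : θ < 1) {a b : ℝ} (ha : 0 < a) (hab : a ≤ b) :
    kernel θ b ≤ kernel θ a :=
  mul_le_mul_of_nonneg_left (Real.rpow_le_rpow_of_nonpos ha hab (by linarith))
    (fracConst_pos h0 h1).le

lemma deriv_auxG {θ : ℝ} (h1 : θ < 1) {t : ℝ} (ht : 0 < t) : deriv (auxG θ) t = auxG' θ t :=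
  (hasDerivAt_auxG h1 ht).deriv

lemma deriv_deriv_auxG {θ : ℝ} (h0 : 0 < θ) (h1 : θ < 1) {t : ℝ} (ht : 0 < t) :
    deriv (deriv (auxG θ)) t = auxG'' θ t := by
  rw [← (hasDerivAt_auxG' h0 ht).deriv]
  refine EventuallyEq.deriv_eq ?_
  filter_upwards [eventually_gt_nhds ht] with x hx using deriv_auxG h1 hx

/-! ### Weights as integrals of the kernel against nodal functions -/

lemma weightAux_one {θ : ℝ} (h0 : 0 < θ) (h1 : θ < 1) :
    weightAux θ 1 = fracConst θ / (2 - 2 * θ) +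
      ∫ t in (1 : ℝ)..3, kernel θ t * ((2 - t) * (3 - t) / 2) := by
  have e : (fun t => kernel θ t * ((2 - t) * (3 - t) / 2)) = fun t =>
      kernel θ t * (3 + (-5 / 2) * t + 1 / 2 * t ^ 2) := by
    funext t; ring
  rw [e, integral_mul_quadratic (fun t => hasDerivAt_auxG h1) (fun t => hasDerivAt_auxG' h0)
    (fun t => hasDerivAt_auxG'' h0) (continuousOn_kernel θ) one_pos (by norm_num)]
  rw [weightAux, if_neg one_ne_zero, if_pos rfl, deriv_deriv_auxG h0 h1 one_pos,
    deriv_auxG h1 one_pos, deriv_auxG h1 (by norm_num)]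
  ring

lemma weightAux_even {θ : ℝ} (h0 : 0 < θ) (h1 : θ < 1) {n : ℕ} (hn : 2 ≤ n) (he : Even n) :
    weightAux θ n = ∫ t in ((n : ℝ) - 1)..(n + 1), kernel θ t * (1 - (t - n) ^ 2) := by
  have hn' : (2 : ℝ) ≤ n := by exact_mod_cast hn
  have e : (fun t => kernel θ t * (1 - (t - n) ^ 2)) = fun t =>
      kernel θ t * ((1 - (n : ℝ) ^ 2) + 2 * n * t + (-1) * t ^ 2) := by
    funext t; ring
  rw [e, integral_mul_quadratic (fun t => hasDerivAt_auxG h1) (fun t => hasDerivAt_auxG' h0)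
    (fun t => hasDerivAt_auxG'' h0) (continuousOn_kernel θ) (by linarith) (by linarith)]
  rw [weightAux, if_neg (by lia), if_neg (by lia), if_pos he,
    deriv_auxG h1 (by linarith), deriv_auxG h1 (by linarith)]
  ring

lemma weightAux_odd {θ : ℝ} (h0 : 0 < θ) (h1 : θ < 1) {n : ℕ} (hn : 3 ≤ n) (ho : ¬Even n) :
    weightAux θ n =
      (∫ t in ((n : ℝ) - 2)..n, kernel θ t * ((t - n + 1) * (t - n + 2) / 2)) +
      ∫ t in (n : ℝ)..(n + 2), kernel θ t * ((n + 1 - t) * (n + 2 - t) / 2) := by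
  have hn' : (3 : ℝ) ≤ n := by exact_mod_cast hn
  rw [integral_odd_node (fun t => hasDerivAt_auxG h1) (fun t => hasDerivAt_auxG' h0)
    (fun t => hasDerivAt_auxG'' h0) (continuousOn_kernel θ) (by linarith)]
  rw [weightAux, if_neg (by lia), if_neg (by lia), if_neg ho,
    deriv_auxG h1 (by linarith), deriv_auxG h1 (by linarith), deriv_auxG h1 (by linarith)]

lemma intervalIntegrable_kernel_mul (θ : ℝ) {a b : ℝ} (ha : 0 < a) (hab : a ≤ b) {p : ℝ → ℝ}
    (hp : Continuous p) : IntervalIntegrable (fun t => kernel θ t * p t) volume a b := by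
  refine ContinuousOn.intervalIntegrable (((continuousOn_kernel θ).mono fun t ht => ?_).mul
    hp.continuousOn)
  rw [uIcc_of_le hab] at ht; exact ha.trans_le ht.1

lemma integral_kernel_mul_le {θ : ℝ} (h0 : 0 < θ) (h1 : θ < 1) {a b : ℝ} (ha : 0 < a)
    (hab : a ≤ b) {p : ℝ → ℝ} (hp : Continuous p) (hp1 : ∀ t ∈ Icc a b, p t ≤ 1) :
    ∫ t in a..b, kernel θ t * p t ≤ (b - a) * kernel θ a := by
  calc ∫ t in a..b, kernel θ t * p t ≤ ∫ _ in a..b, kernel θ a := by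
        refine intervalIntegral.integral_mono_on hab
          (intervalIntegrable_kernel_mul θ ha hab hp) (by simp) fun t ht => ?_
        have hk := kernel_pos h0 h1 (ha.trans_le ht.1)
        calc kernel θ t * p t ≤ kernel θ t * 1 := mul_le_mul_of_nonneg_left (hp1 t ht) hk.le
          _ ≤ kernel θ a := by rw [mul_one]; exact kernel_le_kernel h0 h1 ha ht.1
    _ = (b - a) * kernel θ a := by simp

/-! ### Nonnegativity of the weights -/

lemma weightAux_one_nonneg {θ : ℝ} (h0 : 0 < θ) (h1 : θ < 1) : 0 ≤ weightAux θ 1 := by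
  rw [weightAux_one h0 h1]
  refine add_nonneg (div_nonneg (fracConst_pos h0 h1).le (by linarith)) ?_
  -- The quadratic is nonnegative before t = 2 and nonpositive after it, and the kernel decreases,
  -- so freezing the kernel at 2 can only lower the integral. The quadratic itself has integral 1/3.
  have h : ∫ t in (1 : ℝ)..3, kernel θ 2 * ((2 - t) * (3 - t) / 2) ≤
      ∫ t in (1 : ℝ)..3, kernel θ t * ((2 - t) * (3 - t) / 2) := by
    refine intervalIntegral.integral_mono_on (by norm_num)
      (Continuous.intervalIntegrable (by fun_prop) _ _)
      (intervalIntegrable_kernel_mul θ one_pos (by norm_num) (by fun_prop)) fun t ht => ?_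
    rcases le_total t 2 with h | h
    · exact mul_le_mul_of_nonneg_right (kernel_le_kernel h0 h1 (one_pos.trans_le ht.1) h)
        (by nlinarith [ht.2])
    · exact mul_le_mul_of_nonpos_right (kernel_le_kernel h0 h1 two_pos h) (by nlinarith [ht.2])
  refine le_trans ?_ h
  rw [intervalIntegral.integral_const_mul]
  refine mul_nonneg (kernel_pos h0 h1 two_pos).le ?_
  have e := integral_mul_quadratic (G := fun t => t ^ 3 / 6) (G₁ := fun t => t ^ 2 / 2)
    (G₂ := fun t => t) (K := fun _ => (1 : ℝ))
    (fun t _ => ((hasDerivAt_pow 3 t).div_const 6).congr_deriv (by norm_num; ring))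
    (fun t _ => ((hasDerivAt_pow 2 t).div_const 2).congr_deriv (by norm_num))
    (fun t _ => hasDerivAt_id t) continuousOn_const one_pos (show (1 : ℝ) ≤ 3 by norm_num)
    3 (-5 / 2) (1 / 2)
  have e' : ∀ t : ℝ, (2 - t) * (3 - t) / 2 = 1 * (3 + -5 / 2 * t + 1 / 2 * t ^ 2) :=
    fun t => by ring
  simp_rw [e']
  rw [e]
  norm_num

lemma weightAux_even_nonneg {θ : ℝ} (h0 : 0 < θ) (h1 : θ < 1) {n : ℕ} (hn : 2 ≤ n)
    (he : Even n) : 0 ≤ weightAux θ n := by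
  have hn' : (2 : ℝ) ≤ n := by exact_mod_cast hn
  rw [weightAux_even h0 h1 hn he]
  refine intervalIntegral.integral_nonneg (by linarith) fun t ht => ?_
  exact mul_nonneg (kernel_pos h0 h1 (by linarith [ht.1])).le (by nlinarith [ht.1, ht.2])

/-- With x = 2/m the right side is log((1 + x)/(1 - x)), whose series has positive terms, so a
partial sum suffices. The inequality is the positivity of the odd-node integral for K = t^(-3). -/
lemma log_node_inequality {m : ℝ} (hm : m = 3 ∨ 5 ≤ m) :
    (1 / (m + 2) + 6 / m + 1 / (m - 2)) / 2 ≤ Real.log (m + 2) - Real.log (m - 2) := by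
  have hm3 : 3 ≤ m := by rcases hm with h | h <;> linarith
  set x := 2 / m with hx
  have hx0 : 0 < x := by positivity
  have hx1 : x < 1 := by rw [hx, div_lt_one (by linarith)]; linarith
  have hlog : Real.log (m + 2) - Real.log (m - 2) = Real.log (1 + x) - Real.log (1 - x) := by
    rw [← Real.log_div (by linarith) (by linarith), ← Real.log_div (by linarith) (by linarith)]
    congr 1
    have : m - 2 ≠ 0 := by linarith
    have : m ≠ 0 := by linarith
    rw [hx]; field_simp
  have hs := Real.hasSum_log_sub_log_of_abs_lt_one (x := x) (by rw [abs_of_pos hx0]; exact hx1)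
  have hle : ∀ N : ℕ, ∑ k ∈ Finset.range N, (2 : ℝ) * (1 / (2 * k + 1)) * x ^ (2 * k + 1) ≤
      Real.log (m + 2) - Real.log (m - 2) := fun N => by
    rw [hlog]
    exact sum_le_hasSum _ (fun k _ => by positivity) hs
  rcases hm with rfl | hm
  -- Two terms do not suffice at m = 3, where m² < 16.
  · refine le_trans ?_ (hle 5)
    rw [hx]; norm_num [Finset.sum_range_succ]
  · refine le_trans ?_ (hle 2)
    have h2 : m - 2 ≠ 0 := by linarith
    have h3 : m + 2 ≠ 0 := by linarith
    have h4 : m ≠ 0 := by linarith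
    have e : (∑ k ∈ Finset.range 2, (2 : ℝ) * (1 / (2 * k + 1)) * x ^ (2 * k + 1)) -
        (1 / (m + 2) + 6 / m + 1 / (m - 2)) / 2 =
        (4 / 3) * (m ^ 2 - 16) / (m ^ 3 * ((m + 2) * (m - 2))) := by
      rw [hx, Finset.sum_range_succ, Finset.sum_range_one]
      norm_num
      field_simp
      ring
    have : 0 ≤ (4 / 3) * (m ^ 2 - 16) / (m ^ 3 * ((m + 2) * (m - 2))) :=
      div_nonneg (by nlinarith) (mul_nonneg (by positivity) (by nlinarith))
    linarith

/-- The position of a concave function relative to one of its chords. -/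
lemma chord_of_concaveOn {f : ℝ → ℝ} {s : Set ℝ} (hf : ConcaveOn ℝ s f) {x₀ x₁ : ℝ} (h₀ : x₀ ∈ s)
    (h₁ : x₁ ∈ s) (h : x₀ < x₁) {x : ℝ} (hx : x ∈ s) :
    (x ∈ Icc x₀ x₁ → f x₀ + (f x₁ - f x₀) / (x₁ - x₀) * (x - x₀) ≤ f x) ∧
    (x ≤ x₀ ∨ x₁ ≤ x → f x ≤ f x₀ + (f x₁ - f x₀) / (x₁ - x₀) * (x - x₀)) := by
  have hd : 0 < x₁ - x₀ := sub_pos.2 h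
  constructor
  · rintro ⟨ha, hb⟩
    rcases ha.eq_or_lt with rfl | ha
    · simp
    rcases hb.eq_or_lt with rfl | hb
    · rw [div_mul_cancel₀ _ hd.ne']; linarith
    have := hf.slope_anti_adjacent h₀ h₁ ha hb
    rw [div_le_div_iff₀ (by linarith) (by linarith)] at this
    have e : f x₀ + (f x₁ - f x₀) / (x₁ - x₀) * (x - x₀) =
      (f x₀ * (x₁ - x) + f x₁ * (x - x₀)) / (x₁ - x₀) := by field_simp; ring
    rw [e, div_le_iff₀ hd]
    nlinarith
  · have e : f x₀ + (f x₁ - f x₀) / (x₁ - x₀) * (x - x₀) =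
      (f x₀ * (x₁ - x) + f x₁ * (x - x₀)) / (x₁ - x₀) := by field_simp; ring
    rw [e, le_div_iff₀ hd]
    rintro (ha | hb)
    · rcases ha.eq_or_lt with rfl | ha
      · linarith
      have := hf.slope_anti_adjacent hx h₁ ha h
      rw [div_le_div_iff₀ (by linarith) (by linarith)] at this
      nlinarith
    · rcases hb.eq_or_lt with rfl | hb
      · linarith
      have := hf.slope_anti_adjacent h₀ hx h hb
      rw [div_le_div_iff₀ (by linarith) (by linarith)] at this
      nlinarith

/-- Interpolation of `t ^ (-2θ - 1)` between `1` and `t ^ (-3)` at two nodes. -/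
lemma exists_kernel_interpolation {θ : ℝ} (h0 : 0 < θ) (h1 : θ < 1) {a b : ℝ} (ha : 0 < a)
    (hab : a < b) :
    ∃ α β : ℝ, 0 ≤ α ∧ 0 ≤ β ∧ ∀ t, 0 < t →
      (t ∈ Icc a b → α * t ^ (-3 : ℝ) + β ≤ kernel θ t) ∧
      (t ≤ a ∨ b ≤ t → kernel θ t ≤ α * t ^ (-3 : ℝ) + β) := by
  -- Since 0 < (2θ + 1)/3 < 1, the kernel is a concave function of x = t^(-3), and interpolation in
  -- t is a chord in x. The map t ↦ t^(-3) reverses order, so b gives the left endpoint.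
  set f : ℝ → ℝ := fun x => x ^ ((2 * θ + 1) / 3) with hf
  have hconc : ConcaveOn ℝ (Ici 0) f := Real.concaveOn_rpow (by linarith) (by linarith)
  have hb : 0 < b := ha.trans hab
  have hx : ∀ t : ℝ, 0 < t → 0 < t ^ (-3 : ℝ) := fun t ht => Real.rpow_pos_of_pos ht _
  have hanti : ∀ {s t : ℝ}, 0 < s → s ≤ t → t ^ (-3 : ℝ) ≤ s ^ (-3 : ℝ) := fun hs hst =>
    Real.rpow_le_rpow_of_nonpos hs hst (by norm_num)
  have hlt : b ^ (-3 : ℝ) < a ^ (-3 : ℝ) := Real.rpow_lt_rpow_of_neg ha hab (by norm_num)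
  have hker : ∀ t, 0 < t → kernel θ t = fracConst θ * f (t ^ (-3 : ℝ)) := fun t ht => by
    rw [hf, kernel]
    simp only
    rw [← Real.rpow_mul ht.le]
    congr 2; ring
  have hC := (fracConst_pos h0 h1).le
  set S := (f (a ^ (-3 : ℝ)) - f (b ^ (-3 : ℝ))) / (a ^ (-3 : ℝ) - b ^ (-3 : ℝ)) with hS
  have hline : ∀ t : ℝ, fracConst θ * S * t ^ (-3 : ℝ) +
      fracConst θ * (f (b ^ (-3 : ℝ)) - S * b ^ (-3 : ℝ)) =
      fracConst θ * (f (b ^ (-3 : ℝ)) + S * (t ^ (-3 : ℝ) - b ^ (-3 : ℝ))) := fun t => by ring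
  have hmono : f (b ^ (-3 : ℝ)) ≤ f (a ^ (-3 : ℝ)) :=
    Real.rpow_le_rpow (hx b hb).le hlt.le (by linarith)
  refine ⟨fracConst θ * S, fracConst θ * (f (b ^ (-3 : ℝ)) - S * b ^ (-3 : ℝ)),
    mul_nonneg hC (div_nonneg (by linarith) (by linarith)), mul_nonneg hC ?_, fun t ht => ?_⟩
  -- β is a multiple of the value at x = 0 of the line through the chord; left of the chord the line
  -- lies above f, and f 0 = 0.
  · have := (chord_of_concaveOn hconc (mem_Ici.2 (hx b hb).le) (mem_Ici.2 (hx a ha).le) hlt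
      (x := 0) (mem_Ici.2 le_rfl)).2 (Or.inl (hx b hb).le)
    have hf0 : f 0 = 0 := Real.zero_rpow (by positivity)
    rw [hf0, ← hS] at this
    linarith
  · have := chord_of_concaveOn hconc (mem_Ici.2 (hx b hb).le) (mem_Ici.2 (hx a ha).le) hlt
      (x := t ^ (-3 : ℝ)) (mem_Ici.2 (hx t ht).le)
    rw [hline, hker t ht]
    refine ⟨fun hm => mul_le_mul_of_nonneg_left
      (this.1 ⟨hanti ht hm.2, hanti ha hm.1⟩) hC, fun hm => mul_le_mul_of_nonneg_left
      (this.2 ?_) hC⟩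
    rcases hm with hm | hm
    · exact Or.inr (hanti ht hm)
    · exact Or.inl (hanti hb hm)

lemma weightAux_odd_nonneg {θ : ℝ} (h0 : 0 < θ) (h1 : θ < 1) {n : ℕ} (hn : 3 ≤ n)
    (ho : ¬Even n) : 0 ≤ weightAux θ n := by
  have hn' : (3 : ℝ) ≤ n := by exact_mod_cast hn
  have hn5 : (n : ℝ) = 3 ∨ (5 : ℝ) ≤ n := by
    rcases hn.eq_or_lt with h | h
    · left; rw [← h]; norm_num
    · right
      have : n ≠ 4 := fun h4 => ho (by rw [h4]; decide)
      exact_mod_cast (show 5 ≤ n by lia)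
  rw [weightAux_odd h0 h1 hn ho]
  generalize (n : ℝ) = m at *
  -- The nodal function changes sign exactly at m - 1 and m + 1 inside its support: positive between
  -- them, negative outside. Interpolating there makes kernel minus interpolant share its sign.
  obtain ⟨α, β, hα, hβ, hαβ⟩ := exists_kernel_interpolation h0 h1
    (show 0 < m - 1 by linarith) (show m - 1 < m + 1 by linarith)
  have hcont : ContinuousOn (fun t : ℝ => α * t ^ (-3 : ℝ) + β) (Ioi 0) :=
    (continuousOn_const.mul (continuousOn_id.rpow_const fun _ hx =>
      Or.inl (ne_of_gt hx))).add continuousOn_const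
  have hint : ∀ {a b : ℝ} {p : ℝ → ℝ}, 0 < a → a ≤ b → Continuous p →
      IntervalIntegrable (fun t : ℝ => (α * t ^ (-3 : ℝ) + β) * p t) volume a b :=
    fun ha hab hp => ContinuousOn.intervalIntegrable ((hcont.mono fun t ht => by
      rw [uIcc_of_le hab] at ht; exact ha.trans_le ht.1).mul hp.continuousOn)
  have hA := integral_odd_node (G := fun t => α * (Real.log t / 2) + β * (t ^ 3 / 6))
    (G₁ := fun t => α * (1 / (2 * t)) + β * (t ^ 2 / 2))
    (G₂ := fun t => α * (-1 / (2 * t ^ 2)) + β * t)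
    (K := fun t : ℝ => α * t ^ (-3 : ℝ) + β)
    (fun t ht => by
      refine ((((Real.hasDerivAt_log ht.ne').div_const 2).const_mul α).add
        (((hasDerivAt_pow 3 t).div_const 6).const_mul β)).congr_deriv ?_
      field_simp; norm_num; ring)
    (fun t ht => by
      have hd : HasDerivAt (fun t : ℝ => 1 / (2 * t)) (-1 / (2 * t ^ 2)) t := by
        have := (((hasDerivAt_id t).const_mul 2).fun_inv (by simpa using ht.ne'))
        simp only [id, one_div] at this ⊢
        refine this.congr_deriv ?_
        field_simp
      refine ((hd.const_mul α).add
        (((hasDerivAt_pow 2 t).div_const 2).const_mul β)).congr_deriv ?_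
      norm_num)
    (fun t ht => by
      have hd : HasDerivAt (fun t : ℝ => -1 / (2 * t ^ 2)) (t ^ (-3 : ℝ)) t := by
        have := (((hasDerivAt_pow 2 t).const_mul 2).fun_inv
          (by positivity : (2 * t ^ 2 : ℝ) ≠ 0)).neg
        have e : (fun t : ℝ => -1 / (2 * t ^ 2)) = fun t => -(2 * t ^ 2)⁻¹ := by
          funext t; rw [neg_div, one_div]
        rw [e]
        refine this.congr_deriv ?_
        rw [show (-3 : ℝ) = ((-3 : ℤ) : ℝ) by norm_num, Real.rpow_intCast, zpow_neg]
        norm_cast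
        field_simp
        norm_num
      refine ((hd.const_mul α).add ((hasDerivAt_id t).const_mul β)).congr_deriv ?_
      ring)
    hcont (show 2 < m by linarith)
  have hlower : 0 ≤ (∫ t in (m - 2)..m, (α * t ^ (-3 : ℝ) + β) * ((t - m + 1) * (t - m + 2) / 2)) +
      ∫ t in m..(m + 2), (α * t ^ (-3 : ℝ) + β) * ((m + 1 - t) * (m + 2 - t) / 2) := by
    rw [hA]
    have hl := log_node_inequality hn5
    have h2 : m - 2 ≠ 0 := by linarith
    have h3 : m + 2 ≠ 0 := by linarith
    have h4 : m ≠ 0 := by linarith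
    -- The constant part contributes the integral 2/3 of the nodal function, the t^(-3) part the
    -- logarithmic inequality.
    have e : -(α * (1 / (2 * (m + 2))) + β * ((m + 2) ^ 2 / 2) +
        6 * (α * (1 / (2 * m)) + β * (m ^ 2 / 2)) +
        (α * (1 / (2 * (m - 2))) + β * ((m - 2) ^ 2 / 2))) / 2 +
        (α * (Real.log (m + 2) / 2) + β * ((m + 2) ^ 3 / 6)) -
        (α * (Real.log (m - 2) / 2) + β * ((m - 2) ^ 3 / 6)) =
        α / 2 * (Real.log (m + 2) - Real.log (m - 2) -
          (1 / (m + 2) + 6 / m + 1 / (m - 2)) / 2) + β * (2 / 3) := by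
      field_simp
      ring
    rw [e]
    exact add_nonneg (mul_nonneg (by linarith) (by linarith)) (by linarith)
  refine hlower.trans (add_le_add ?_ ?_)
  · refine intervalIntegral.integral_mono_on (by linarith)
      (hint (by linarith) (by linarith) (by fun_prop))
      (intervalIntegrable_kernel_mul θ (by linarith) (by linarith) (by fun_prop)) fun t ht => ?_
    have ht0 : 0 < t := by linarith [ht.1]
    rcases le_total t (m - 1) with h | h
    · exact mul_le_mul_of_nonpos_right ((hαβ t ht0).2 (Or.inl h)) (by nlinarith [ht.1])
    · exact mul_le_mul_of_nonneg_right ((hαβ t ht0).1 ⟨h, by linarith [ht.2]⟩) (by nlinarith)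
  · refine intervalIntegral.integral_mono_on (by linarith)
      (hint (by linarith) (by linarith) (by fun_prop))
      (intervalIntegrable_kernel_mul θ (by linarith) (by linarith) (by fun_prop)) fun t ht => ?_
    have ht0 : 0 < t := by linarith [ht.1]
    rcases le_total (m + 1) t with h | h
    · exact mul_le_mul_of_nonpos_right ((hαβ t ht0).2 (Or.inr h)) (by nlinarith [ht.2])
    · exact mul_le_mul_of_nonneg_right ((hαβ t ht0).1 ⟨by linarith [ht.1], h⟩) (by nlinarith)

lemma weightAux_nonneg {θ : ℝ} (h0 : 0 < θ) (h1 : θ < 1) (n : ℕ) : 0 ≤ weightAux θ n := by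
  rcases Nat.lt_or_ge n 2 with h | h
  · interval_cases n
    · simp [weightAux]
    · exact weightAux_one_nonneg h0 h1
  · by_cases he : Even n
    · exact weightAux_even_nonneg h0 h1 h he
    · refine weightAux_odd_nonneg h0 h1 ?_ he
      have : n ≠ 2 := fun h2 => he (by rw [h2]; decide)
      lia

/-! ### Decay and summability of the weights -/

lemma weightAux_add_three_le {θ : ℝ} (h0 : 0 < θ) (h1 : θ < 1) (n : ℕ) :
    weightAux θ (n + 3) ≤ 4 * kernel θ (n + 1) := by
  have hn : (0 : ℝ) ≤ n := n.cast_nonneg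
  by_cases he : Even (n + 3)
  · rw [weightAux_even h0 h1 (by lia) he]
    refine (integral_kernel_mul_le h0 h1 (by push_cast; linarith) (by linarith) (by fun_prop)
      fun t _ => by nlinarith).trans ?_
    have := kernel_le_kernel h0 h1 (show (0 : ℝ) < n + 1 by positivity)
      (show (n + 1 : ℝ) ≤ ((n + 3 : ℕ) : ℝ) - 1 by push_cast; linarith)
    have := kernel_pos h0 h1 (show (0 : ℝ) < n + 1 by positivity)
    push_cast at *
    nlinarith
  · rw [weightAux_odd h0 h1 (by lia) he]
    -- The nodal function is at most 1 on its two halves of length 2, so each half contributes at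
    -- most 2 K(n + 1).
    have i1 := integral_kernel_mul_le h0 h1 (a := ((n + 3 : ℕ) : ℝ) - 2) (b := (n + 3 : ℕ))
      (p := fun t => (t - (n + 3 : ℕ) + 1) * (t - (n + 3 : ℕ) + 2) / 2)
      (by push_cast; linarith) (by linarith) (by fun_prop)
      fun t ht => by nlinarith [ht.1, ht.2]
    have i2 := integral_kernel_mul_le h0 h1 (a := (n + 3 : ℕ)) (b := ((n + 3 : ℕ) : ℝ) + 2)
      (p := fun t => ((n + 3 : ℕ) + 1 - t) * ((n + 3 : ℕ) + 2 - t) / 2)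
      (by push_cast; linarith) (by linarith) (by fun_prop)
      fun t ht => by nlinarith [ht.1, ht.2]
    have k := kernel_le_kernel h0 h1 (show (0 : ℝ) < n + 1 by positivity)
      (show (n + 1 : ℝ) ≤ ((n + 3 : ℕ) : ℝ) by push_cast; linarith)
    have e : ((n + 3 : ℕ) : ℝ) - 2 = n + 1 := by push_cast; ring
    rw [e] at i1
    rw [e]
    have e2 : ((n + 3 : ℕ) : ℝ) - (n + 1) = 2 := by push_cast; ring
    have e3 : ((n + 3 : ℕ) : ℝ) + 2 - (n + 3 : ℕ) = 2 := by ring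
    rw [e2] at i1
    rw [e3] at i2
    linarith

lemma summable_weightAux {θ : ℝ} (h0 : 0 < θ) (h1 : θ < 1) : Summable (weightAux θ) := by
  rw [← summable_nat_add_iff 3]
  refine Summable.of_nonneg_of_le (fun n => weightAux_nonneg h0 h1 _)
    (weightAux_add_three_le h0 h1) ?_
  have h := (summable_nat_add_iff 1).2
    (Real.summable_nat_rpow.2 (show -(2 * θ) - 1 < -1 by linarith))
  simpa [kernel, Nat.cast_add] using (h.mul_left (fracConst θ)).mul_left 4

lemma weight_nonneg {θ h : ℝ} (h0 : 0 < θ) (h1 : θ < 1) (hh : 0 < h) (j : ℤ) :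
    0 ≤ weight θ h j :=
  mul_nonneg (Real.rpow_nonneg hh.le _) (weightAux_nonneg h0 h1 _)

lemma weight_neg (θ h : ℝ) (j : ℤ) : weight θ h (-j) = weight θ h j := by
  simp [weight]

lemma summable_weight {θ : ℝ} (h : ℝ) (h0 : 0 < θ) (h1 : θ < 1) :
    Summable (weight θ h) := by
  have : Summable fun j : ℤ => weightAux θ j.natAbs := by
    refine summable_int_iff_summable_nat_and_neg.2 ⟨?_, ?_⟩ <;>
      simpa using summable_weightAux h0 h1
  exact this.mul_left _

/-! ### The discrete fractional Laplacian on finitely supported sequences -/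

/-- The indices `|i| ≤ M`. -/
abbrev Node (M : ℕ) : Type := ↥(Finset.Icc (-(M : ℤ)) M)

/-- Extension by zero. -/
noncomputable def extend {M : ℕ} (x : Node M → ℝ) (i : ℤ) : ℝ :=
  if hi : i ∈ Finset.Icc (-(M : ℤ)) M then x ⟨i, hi⟩ else 0

/-- Restriction to the indices `|i| ≤ M`. -/
noncomputable def toNode (M : ℕ) (f : ℤ → ℝ) (i : Node M) : ℝ := f i

lemma mem_nodes {M : ℕ} {i : ℤ} : i ∈ Finset.Icc (-(M : ℤ)) M ↔ |i| ≤ (M : ℤ) := by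
  rw [Finset.mem_Icc, abs_le]

@[simp] lemma extend_coe {M : ℕ} (x : Node M → ℝ) (i : Node M) : extend x i = x i := by
  simp only [extend, dif_pos i.2]

lemma extend_of_lt {M : ℕ} (x : Node M → ℝ) {i : ℤ} (hi : (M : ℤ) < |i|) : extend x i = 0 := by
  rw [extend, dif_neg (by rw [mem_nodes]; exact not_le.2 hi)]

lemma extend_toNode {M : ℕ} {f : ℤ → ℝ} (hf : ∀ i : ℤ, (M : ℤ) < |i| → f i = 0) :
    extend (toNode M f) = f := by
  funext i
  by_cases hi : i ∈ Finset.Icc (-(M : ℤ)) M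
  · simp [extend, dif_pos hi, toNode]
  · rw [extend, dif_neg hi, hf i (by rw [mem_nodes] at hi; exact not_le.1 hi)]

lemma fracLap_eq_sub_sum {θ h : ℝ} (h0 : 0 < θ) (h1 : θ < 1) {M : ℕ} {f : ℤ → ℝ}
    (hf : ∀ i : ℤ, (M : ℤ) < |i| → f i = 0) (i : ℤ) :
    fracLap θ h f i = (∑' j, weight θ h j) * f i -
      ∑ k ∈ Finset.Icc (-(M : ℤ)) M, weight θ h (i - k) * f k := by
  have hw := summable_weight h h0 h1
  have hs : HasSum (fun k => weight θ h (i - k) * f k)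
      (∑ k ∈ Finset.Icc (-(M : ℤ)) M, weight θ h (i - k) * f k) :=
    hasSum_sum_of_ne_finset_zero fun k hk => by
      rw [mem_nodes, not_le] at hk
      rw [hf k hk, mul_zero]
  have hs' := (Equiv.subLeft i).hasSum_iff.2 hs
  have := (hw.hasSum.mul_right (f i)).sub hs'
  rw [fracLap, ← this.tsum_eq]
  refine tsum_congr fun j => ?_
  simp [mul_sub]

/-- Expand the square. The two square terms are finitely supported in one index and summable in the
weight, and agree up to the shift `e`. The cross term has finite support in the coordinates (i, i -
j), reached by `e'`. -/
lemma hasSum_gagliardo {θ h : ℝ} (h0 : 0 < θ) (h1 : θ < 1) (hh : 0 < h) {M : ℕ} {f : ℤ → ℝ}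
    (hf : ∀ i : ℤ, (M : ℤ) < |i| → f i = 0) :
    HasSum (fun p : ℤ × ℤ => h * weight θ h p.2 * |f p.1 - f (p.1 - p.2)| ^ 2)
      (2 * (h * ∑ i ∈ Finset.Icc (-(M : ℤ)) M, fracLap θ h f i * f i)) := by
  have hw := summable_weight h h0 h1
  have hz : ∀ i ∉ Finset.Icc (-(M : ℤ)) M, f i = 0 := fun i hi => by
    rw [mem_nodes, not_le] at hi
    exact hf i hi
  have hf2 : HasSum (fun i => f i ^ 2) (∑ i ∈ Finset.Icc (-(M : ℤ)) M, f i ^ 2) :=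
    hasSum_sum_of_ne_finset_zero fun i hi => by simp [hz i hi]
  have hdiag : HasSum (fun p : ℤ × ℤ => f p.1 ^ 2 * weight θ h p.2)
      ((∑ i ∈ Finset.Icc (-(M : ℤ)) M, f i ^ 2) * ∑' j, weight θ h j) :=
    hf2.mul hw.hasSum (Summable.mul_of_nonneg hf2.summable hw (fun i => sq_nonneg _)
      (fun j => weight_nonneg h0 h1 hh j))
  let e : ℤ × ℤ ≃ ℤ × ℤ :=
    { toFun := fun p => (p.1 - p.2, p.2)
      invFun := fun p => (p.1 + p.2, p.2)
      left_inv := fun p => by simp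
      right_inv := fun p => by simp }
  let e' : ℤ × ℤ ≃ ℤ × ℤ :=
    { toFun := fun p => (p.1, p.1 - p.2)
      invFun := fun p => (p.1, p.1 - p.2)
      left_inv := fun p => by simp
      right_inv := fun p => by simp }
  have hshift := e.hasSum_iff.2 hdiag
  have hcross : HasSum (fun p : ℤ × ℤ => weight θ h (p.1 - p.2) * f p.2 * f p.1)
      (∑ p ∈ Finset.Icc (-(M : ℤ)) M ×ˢ Finset.Icc (-(M : ℤ)) M,
        weight θ h (p.1 - p.2) * f p.2 * f p.1) :=
    hasSum_sum_of_ne_finset_zero fun p hp => by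
      rw [Finset.mem_product, not_and_or] at hp
      rcases hp with hp | hp <;> simp [hz _ hp]
  have hcross' := e'.hasSum_iff.2 hcross
  have := ((hdiag.add hshift).sub (hcross'.mul_left 2)).mul_left h
  convert! this using 1
  · funext p
    simp only [Function.comp_apply, e, e', Equiv.coe_fn_mk, sq_abs, sub_sub_cancel]
    ring
  · rw [Finset.sum_product]
    simp_rw [fracLap_eq_sub_sum h0 h1 hf, sub_mul, Finset.sum_mul]
    rw [Finset.sum_sub_distrib]
    have : ∀ i, (∑' j, weight θ h j) * f i * f i = f i ^ 2 * ∑' j, weight θ h j :=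
      fun i => by ring
    simp_rw [this]
    ring

lemma sq_xNorm {θ h : ℝ} (h0 : 0 < θ) (h1 : θ < 1) (hh : 0 < h) {M : ℕ} {f : ℤ → ℝ}
    (hf : ∀ i : ℤ, (M : ℤ) < |i| → f i = 0) :
    xNorm θ h f ^ 2 = h * ∑ i ∈ Finset.Icc (-(M : ℤ)) M, fracLap θ h f i * f i := by
  have hs := hasSum_gagliardo h0 h1 hh hf
  rw [xNorm, Real.sq_sqrt, hs.tsum_eq]
  · ring
  · exact mul_nonneg (by norm_num) (tsum_nonneg fun p =>
      mul_nonneg (mul_nonneg hh.le (weight_nonneg h0 h1 hh _)) (by positivity))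

/-- The matrix of the discrete fractional Laplacian with exterior condition zero. -/
noncomputable def lap (θ h : ℝ) (M : ℕ) : (Node M → ℝ) →ₗ[ℝ] (Node M → ℝ) where
  toFun x i := (∑' j, weight θ h j) * x i - ∑ k : Node M, weight θ h (i - k) * x k
  map_add' x y := by
    funext i
    simp only [Pi.add_apply, mul_add, Finset.sum_add_distrib]
    ring
  map_smul' c x := by
    funext i
    simp only [Pi.smul_apply, smul_eq_mul, RingHom.id_apply, mul_sub, Finset.mul_sum]
    congr 1
    · ring
    · exact Finset.sum_congr rfl fun k _ => by ring

lemma fracLap_extend {θ h : ℝ} (h0 : 0 < θ) (h1 : θ < 1) {M : ℕ} (x : Node M → ℝ) (i : Node M) :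
    fracLap θ h (extend x) i = lap θ h M x i := by
  rw [fracLap_eq_sub_sum h0 h1 (fun _ => extend_of_lt x), extend_coe, ← Finset.sum_coe_sort]
  simp [lap]

lemma sq_xNorm_extend {θ h : ℝ} (h0 : 0 < θ) (h1 : θ < 1) (hh : 0 < h) {M : ℕ}
    (x : Node M → ℝ) : xNorm θ h (extend x) ^ 2 = h * dotProduct (lap θ h M x) x := by
  rw [sq_xNorm h0 h1 hh (fun _ => extend_of_lt x), ← Finset.sum_coe_sort]
  simp [dotProduct, fracLap_extend h0 h1]

lemma lap_nonneg {θ h : ℝ} (h0 : 0 < θ) (h1 : θ < 1) (hh : 0 < h) {M : ℕ} (x : Node M → ℝ) :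
    0 ≤ dotProduct (lap θ h M x) x := by
  have := sq_xNorm_extend h0 h1 hh x
  by_contra! hlt
  nlinarith [sq_nonneg (xNorm θ h (extend x))]

lemma lap_symm (θ h : ℝ) {M : ℕ} (x y : Node M → ℝ) :
    dotProduct (lap θ h M x) y = dotProduct (lap θ h M y) x := by
  simp only [dotProduct, lap, LinearMap.coe_mk, AddHom.coe_mk, sub_mul, Finset.sum_sub_distrib,
    Finset.sum_mul]
  congr 1
  · exact Finset.sum_congr rfl fun i _ => by ring
  · rw [Finset.sum_comm]
    refine Finset.sum_congr rfl fun i _ => Finset.sum_congr rfl fun k _ => ?_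
    rw [← weight_neg, neg_sub]
    ring

lemma lNorm_rpow_extend {h p : ℝ} (hh : 0 < h) (hp : 0 < p) {M : ℕ} (x : Node M → ℝ) :
    lNorm h p (extend x) ^ p = h * ∑ i, |x i| ^ p := by
  have hs : ∑' i : ℤ, h * |extend x i| ^ p = h * ∑ i, |x i| ^ p := by
    rw [tsum_eq_sum (s := Finset.Icc (-(M : ℤ)) M), ← Finset.sum_coe_sort, Finset.mul_sum]
    · simp
    · intro i hi
      rw [mem_nodes, not_le] at hi
      rw [extend_of_lt x hi, abs_zero, Real.zero_rpow hp.ne', mul_zero]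
  rw [lNorm, hs, one_div, Real.rpow_inv_rpow _ hp.ne']
  exact mul_nonneg hh.le (Finset.sum_nonneg fun i _ => Real.rpow_nonneg (abs_nonneg _) _)

lemma sq_lNorm_two_extend {h : ℝ} (hh : 0 < h) {M : ℕ} (x : Node M → ℝ) :
    lNorm h 2 (extend x) ^ 2 = h * ∑ i, x i ^ 2 := by
  rw [← Real.rpow_natCast, Nat.cast_two, lNorm_rpow_extend hh two_pos]
  simp

lemma summable_lNorm_extend (h : ℝ) {p : ℝ} (hp : 0 < p) {M : ℕ} (x : Node M → ℝ) :
    Summable fun i : ℤ => h * |extend x i| ^ p := by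
  refine summable_of_ne_finset_zero (s := Finset.Icc (-(M : ℤ)) M) fun i hi => ?_
  rw [mem_nodes, not_le] at hi
  rw [extend_of_lt x hi, abs_zero, Real.zero_rpow hp.ne', mul_zero]

/-! ### Implicit Euler steps for `d/dt v^(q-1) + A v = 0` -/

/-- Symmetric positive semidefinite operators on `ι → ℝ`. -/
structure IsPSD {ι : Type*} [Fintype ι] (A : (ι → ℝ) →ₗ[ℝ] (ι → ℝ)) : Prop where
  symm : ∀ x y, dotProduct (A x) y = dotProduct (A y) x
  nonneg : ∀ x, 0 ≤ dotProduct (A x) x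

section PSD

variable {ι : Type*} [Fintype ι] {A : (ι → ℝ) →ₗ[ℝ] (ι → ℝ)}

lemma IsPSD.energy_add_smul (hA : IsPSD A) (x d : ι → ℝ) (t : ℝ) :
    dotProduct (A (x + t • d)) (x + t • d) =
      dotProduct (A x) x + t * (2 * dotProduct (A x) d) + t ^ 2 * dotProduct (A d) d := by
  simp only [map_add, map_smul, add_dotProduct, dotProduct_add, smul_dotProduct, dotProduct_smul,
    smul_eq_mul, hA.symm d x]
  ring

lemma IsPSD.energy_sub_le (hA : IsPSD A) (x y : ι → ℝ) :
    dotProduct (A x) x - dotProduct (A y) y ≤ 2 * dotProduct (A x) (x - y) := by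
  have h := hA.energy_add_smul x (x - y) (-1)
  have h' := hA.nonneg (x - y)
  rw [show x + (-1 : ℝ) • (x - y) = y by simp] at h
  linarith

lemma IsPSD.sq_dotProduct_le (hA : IsPSD A) (x y : ι → ℝ) :
    dotProduct (A x) y ^ 2 ≤ dotProduct (A x) x * dotProduct (A y) y := by
  have h := discrim_le_zero (a := dotProduct (A y) y) (b := 2 * dotProduct (A x) y)
    (c := dotProduct (A x) x) fun t => by
      have := hA.nonneg (x + t • y)
      rw [hA.energy_add_smul] at this
      linarith
  rw [discrim] at h
  linarith

/-- Cauchy-Schwarz for the semidefinite form, tested against coordinate vectors. Energy thus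
controls A x even if A has a kernel. -/
lemma IsPSD.exists_sq_apply_le (hA : IsPSD A) :
    ∃ C : ℝ, 0 ≤ C ∧ ∀ x i, A x i ^ 2 ≤ C * dotProduct (A x) x := by
  classical
  have hd : ∀ i, 0 ≤ dotProduct (A (Pi.single i 1)) (Pi.single i 1) := fun i => hA.nonneg _
  refine ⟨∑ i, dotProduct (A (Pi.single i 1)) (Pi.single i 1),
    Finset.sum_nonneg fun i _ => hd i, fun x i => ?_⟩
  have h := hA.sq_dotProduct_le x (Pi.single i 1)
  have h1 : dotProduct (A x) (Pi.single i 1) = A x i := by simp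
  rw [h1] at h
  rw [mul_comm]
  exact h.trans (mul_le_mul_of_nonneg_left
    (Finset.single_le_sum (f := fun i => dotProduct (A (Pi.single i 1)) (Pi.single i 1))
      (fun i _ => hd i) (Finset.mem_univ i)) (hA.nonneg x))

lemma eq_of_sum_oddPow_le_zero {r : ℝ} (hr : 0 < r) {x y : ι → ℝ}
    (h : ∑ i, (oddPow (x i) r - oddPow (y i) r) * (x i - y i) ≤ 0) : x = y := by
  have h0 := (Finset.sum_eq_zero_iff_of_nonneg
    (fun i _ => oddPow_sub_mul_sub_nonneg hr (x i) (y i))).1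
    (le_antisymm h (Finset.sum_nonneg fun i _ => oddPow_sub_mul_sub_nonneg hr (x i) (y i)))
  exact funext fun i => eq_of_oddPow_sub_mul_sub_eq_zero hr (h0 i (Finset.mem_univ i))

/-- Testing the difference of the equations with x - y leaves two nonnegative terms of zero sum, and
the power is strictly increasing. -/
lemma IsPSD.euler_step_unique (hA : IsPSD A) {q τ : ℝ} (hq : 1 < q) (hτ : 0 < τ) {b x y : ι → ℝ}
    (hx : ∀ i, oddPow (x i) (q - 1) + τ * A x i = b i)
    (hy : ∀ i, oddPow (y i) (q - 1) + τ * A y i = b i) : x = y := by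
  refine eq_of_sum_oddPow_le_zero (r := q - 1) (by linarith) ?_
  have h : ∑ i, (oddPow (x i) (q - 1) - oddPow (y i) (q - 1)) * (x i - y i) =
      -(τ * dotProduct (A (x - y)) (x - y)) := by
    rw [dotProduct, Finset.mul_sum, ← Finset.sum_neg_distrib]
    refine Finset.sum_congr rfl fun i _ => ?_
    simp only [map_sub, Pi.sub_apply]
    linear_combination (x i - y i) * (hx i - hy i)
  rw [h]
  exact neg_nonpos.2 (mul_nonneg hτ.le (hA.nonneg _))

lemma exists_abs_sub_le_rpow {q : ℝ} (hq : 1 < q) (b : ℝ) :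
    ∃ C : ℝ, 0 ≤ C ∧ ∀ x : ℝ, |x| - C ≤ |x| ^ q / q - b * x := by
  have hc := Real.HolderConjugate.conjExponent hq
  refine ⟨(|b| + 1) ^ Real.conjExponent q / Real.conjExponent q, ?_, fun x => ?_⟩
  · exact div_nonneg (Real.rpow_nonneg (by positivity) _) hc.symm.nonneg
  -- Young with |b| + 1 instead of |b| leaves one spare |x| for coercivity.
  · have h := Real.young_inequality_of_nonneg (abs_nonneg x)
      (show 0 ≤ |b| + 1 by positivity) hc
    have h2 : b * x ≤ |b| * |x| := by rw [← abs_mul]; exact le_abs_self _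
    linarith

lemma IsPSD.exists_euler_step (hA : IsPSD A) {q τ : ℝ} (hq : 1 < q) (hτ : 0 < τ) (b : ι → ℝ) :
    ∃ x : ι → ℝ, ∀ i, oddPow (x i) (q - 1) + τ * A x i = b i := by
  classical
  -- The equation says that the gradient of Φ vanishes. Φ is continuous and, by `hlow`, coercive, so
  -- it has a minimiser.
  set Φ : (ι → ℝ) → ℝ := fun x =>
    ∑ i, (|x i| ^ q / q - b i * x i) + τ / 2 * dotProduct (A x) x with hΦ
  have hAc : Continuous A := A.continuous_of_finiteDimensional
  have hAi : ∀ i, Continuous fun x => A x i := fun i => (continuous_apply i).comp hAc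
  have hcont : Continuous Φ := by
    refine Continuous.add (continuous_finsetSum _ fun i _ => Continuous.sub ?_ ?_)
      (continuous_const.mul (continuous_finsetSum _ fun i _ => ?_))
    · exact (((continuous_apply i).abs).rpow_const fun _ => Or.inr (by linarith)).div_const _
    · exact continuous_const.mul (continuous_apply i)
    · exact (hAi i).mul (continuous_apply i)
  choose C hC0 hC using fun i => exists_abs_sub_le_rpow hq (b i)
  have hlow : ∀ x, ‖x‖ - ∑ i, C i ≤ Φ x := fun x => by
    have h1 : ‖x‖ ≤ ∑ i, |x i| :=
      (pi_norm_le_iff_of_nonneg (Finset.sum_nonneg fun i _ => abs_nonneg _)).2 fun i =>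
        Finset.single_le_sum (f := fun i => |x i|) (fun i _ => abs_nonneg _) (Finset.mem_univ i)
    have h2 := Finset.sum_le_sum fun i (_ : i ∈ Finset.univ) => hC i (x i)
    rw [Finset.sum_sub_distrib] at h2
    have h3 : 0 ≤ τ / 2 * dotProduct (A x) x := mul_nonneg (by positivity) (hA.nonneg x)
    simp only [hΦ]
    linarith
  obtain ⟨x, hx⟩ := hcont.exists_forall_le (tendsto_atTop_mono hlow
    (tendsto_atTop_add_const_right _ _ tendsto_norm_cocompact_atTop))
  refine ⟨x, fun i => ?_⟩
  set d : ι → ℝ := Pi.single i 1 with hd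
  have hderiv : HasDerivAt (fun t : ℝ => Φ (x + t • d))
      (∑ k, (oddPow (x k) (q - 1) * d k - b k * d k) + τ / 2 * (2 * dotProduct (A x) d)) 0 := by
    refine HasDerivAt.add (HasDerivAt.fun_sum fun k _ => ?_) ?_
    · have hl : HasDerivAt (fun t : ℝ => (x + t • d) k) (d k) 0 := by
        simpa using ((hasDerivAt_id (0 : ℝ)).mul_const (d k)).const_add (x k)
      refine HasDerivAt.sub ?_ (hl.const_mul (b k))
      have := hasDerivAt_abs_rpow_div hq ((x + (0 : ℝ) • d) k)
      have h2 := this.comp (0 : ℝ) hl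
      rw [zero_smul, add_zero] at h2
      exact h2
    · simp_rw [hA.energy_add_smul]
      refine HasDerivAt.const_mul _ ?_
      refine ((((hasDerivAt_id (0 : ℝ)).mul_const _).const_add _).add
        ((hasDerivAt_pow 2 (0 : ℝ)).mul_const _)).congr_deriv ?_
      simp
  have hmin : IsLocalMin (fun t : ℝ => Φ (x + t • d)) 0 :=
    Eventually.of_forall fun t => by simpa using hx (x + t • d)
  have h0 := hmin.hasDerivAt_eq_zero hderiv
  simp only [hd, Pi.single_apply, mul_ite, mul_one, mul_zero, Finset.sum_sub_distrib,
    Finset.sum_ite_eq', Finset.mem_univ, if_true, dotProduct] at h0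
  linarith

/-- Sequences of implicit Euler steps. -/
def IsEuler (A : (ι → ℝ) →ₗ[ℝ] (ι → ℝ)) (q dt : ℝ) (u : ℕ → ι → ℝ) : Prop :=
  ∀ n i, oddPow (u (n + 1) i) (q - 1) + dt * A (u (n + 1)) i = oddPow (u n i) (q - 1)

lemma IsPSD.exists_isEuler (hA : IsPSD A) {q dt : ℝ} (hq : 1 < q) (hdt : 0 < dt) (x₀ : ι → ℝ) :
    ∃ u : ℕ → ι → ℝ, u 0 = x₀ ∧ IsEuler A q dt u := by
  choose S hS using fun x : ι → ℝ =>
    hA.exists_euler_step hq hdt fun i => oddPow (x i) (q - 1)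
  exact ⟨fun n => n.rec x₀ fun _ x => S x, rfl, fun n i => hS _ i⟩

lemma IsEuler.unique (hA : IsPSD A) {q dt : ℝ} (hq : 1 < q) (hdt : 0 < dt) {u u' : ℕ → ι → ℝ}
    (hu : IsEuler A q dt u) (hu' : IsEuler A q dt u') (h0 : u 0 = u' 0) : u = u' := by
  funext n
  induction n with
  | zero => exact h0
  | succ n ih => exact hA.euler_step_unique hq hdt (hu n) (fun i => by rw [ih]; exact hu' n i)

/-- Test the step with u (n + 1) - u n: Stroock-Varopoulos bounds the power term from below,
convexity of the energy bounds the A term. -/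
lemma IsEuler.energy_step (hA : IsPSD A) {q dt : ℝ} (hq : 1 < q) (hdt : 0 < dt) {u : ℕ → ι → ℝ}
    (hu : IsEuler A q dt u) (n : ℕ) :
    4 / (q * Real.conjExponent q) *
        ∑ i, (oddPow (u (n + 1) i) (q / 2) - oddPow (u n i) (q / 2)) ^ 2 ≤
      dt * (dotProduct (A (u n)) (u n) / 2 - dotProduct (A (u (n + 1))) (u (n + 1)) / 2) := by
  have h1 : ∑ i, (oddPow (u (n + 1) i) (q - 1) - oddPow (u n i) (q - 1)) *
      (u (n + 1) i - u n i) = -(dt * dotProduct (A (u (n + 1))) (u (n + 1) - u n)) := by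
    rw [dotProduct, Finset.mul_sum, ← Finset.sum_neg_distrib]
    refine Finset.sum_congr rfl fun i _ => ?_
    rw [Pi.sub_apply]
    linear_combination (u (n + 1) i - u n i) * hu n i
  have h2 := hA.energy_sub_le (u (n + 1)) (u n)
  calc _ = ∑ i, 4 / (q * Real.conjExponent q) *
          (oddPow (u (n + 1) i) (q / 2) - oddPow (u n i) (q / 2)) ^ 2 := Finset.mul_sum ..
    _ ≤ ∑ i, (oddPow (u (n + 1) i) (q - 1) - oddPow (u n i) (q - 1)) *
          (u (n + 1) i - u n i) := Finset.sum_le_sum fun i _ => sq_oddPow_half_sub_le hq _ _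
    _ ≤ _ := by rw [h1]; nlinarith

lemma energy_coeff_pos {q : ℝ} (hq : 1 < q) : 0 < 4 / (q * Real.conjExponent q) := by
  have := (Real.HolderConjugate.conjExponent hq).symm.pos
  positivity

lemma IsEuler.energy_antitone (hA : IsPSD A) {q dt : ℝ} (hq : 1 < q) (hdt : 0 < dt)
    {u : ℕ → ι → ℝ} (hu : IsEuler A q dt u) :
    Antitone fun n => dotProduct (A (u n)) (u n) := by
  refine antitone_nat_of_succ_le fun n => ?_
  have h := hu.energy_step hA hq hdt n
  have h' : 0 ≤ 4 / (q * Real.conjExponent q) *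
      ∑ i, (oddPow (u (n + 1) i) (q / 2) - oddPow (u n i) (q / 2)) ^ 2 :=
    mul_nonneg (energy_coeff_pos hq).le (Finset.sum_nonneg fun i _ => sq_nonneg _)
  have := nonneg_of_mul_nonneg_right (h'.trans h) hdt
  linarith

/-- Summing telescopes the energies. Cauchy-Schwarz over the K increments costs the factor K, which
combines with dt to the elapsed time. -/
lemma IsEuler.energy_steps (hA : IsPSD A) {q dt : ℝ} (hq : 1 < q) (hdt : 0 < dt)
    {u : ℕ → ι → ℝ} (hu : IsEuler A q dt u) (m K : ℕ) :
    4 / (q * Real.conjExponent q) *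
        ∑ i, (oddPow (u (m + K) i) (q / 2) - oddPow (u m i) (q / 2)) ^ 2 ≤
      K * dt * (dotProduct (A (u m)) (u m) / 2 - dotProduct (A (u (m + K))) (u (m + K)) / 2) := by
  have hc := (energy_coeff_pos hq).le
  have h1 : ∀ i, (oddPow (u (m + K) i) (q / 2) - oddPow (u m i) (q / 2)) ^ 2 ≤
      K * ∑ k ∈ Finset.range K,
        (oddPow (u (m + (k + 1)) i) (q / 2) - oddPow (u (m + k) i) (q / 2)) ^ 2 := fun i => by
    have := sq_sum_le_card_mul_sum_sq (s := Finset.range K)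
      (f := fun k => oddPow (u (m + (k + 1)) i) (q / 2) - oddPow (u (m + k) i) (q / 2))
    rw [Finset.sum_range_sub (fun k => oddPow (u (m + k) i) (q / 2)), Finset.card_range] at this
    simpa using this
  have h2 := Finset.sum_le_sum fun k (_ : k ∈ Finset.range K) =>
    hu.energy_step hA hq hdt (m + k)
  simp_rw [add_assoc] at h2
  rw [← Finset.mul_sum, ← Finset.mul_sum,
    Finset.sum_range_sub' (fun k => dotProduct (A (u (m + k))) (u (m + k)) / 2),
    Finset.sum_comm] at h2
  calc _ ≤ 4 / (q * Real.conjExponent q) * ∑ i, K * ∑ k ∈ Finset.range K,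
        (oddPow (u (m + (k + 1)) i) (q / 2) - oddPow (u (m + k) i) (q / 2)) ^ 2 :=
        mul_le_mul_of_nonneg_left (Finset.sum_le_sum fun i _ => h1 i) hc
    _ = K * (4 / (q * Real.conjExponent q) * ∑ i, ∑ k ∈ Finset.range K,
        (oddPow (u (m + (k + 1)) i) (q / 2) - oddPow (u (m + k) i) (q / 2)) ^ 2) := by
        rw [← Finset.mul_sum]; ring
    _ ≤ K * (dt * (dotProduct (A (u m)) (u m) / 2 -
        dotProduct (A (u (m + K))) (u (m + K)) / 2)) :=
        mul_le_mul_of_nonneg_left (by simpa using h2) K.cast_nonneg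
    _ = _ := by ring

/-- The energy decreases along the steps, so the initial energy bounds A (u n) independently of both
n and dt. -/
lemma IsEuler.exists_abs_apply_le (hA : IsPSD A) {q : ℝ} (hq : 1 < q) (x₀ : ι → ℝ) :
    ∃ K : ℝ, 0 ≤ K ∧ ∀ {dt : ℝ} {u : ℕ → ι → ℝ}, 0 < dt → IsEuler A q dt u → u 0 = x₀ →
      ∀ n i, |A (u n) i| ≤ K := by
  obtain ⟨C, hC0, hC⟩ := hA.exists_sq_apply_le
  refine ⟨√(C * dotProduct (A x₀) x₀), Real.sqrt_nonneg _, fun hdt hu h0 n i =>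
    Real.abs_le_sqrt ((hC _ i).trans (mul_le_mul_of_nonneg_left ?_ hC0))⟩
  rw [← h0]
  exact hu.energy_antitone hA hq hdt (Nat.zero_le n)

end PSD

lemma IsEuler.abs_oddPow_le {ι : Type*} {A : (ι → ℝ) →ₗ[ℝ] (ι → ℝ)} {q dt K : ℝ} (hdt : 0 < dt) {u : ℕ → ι → ℝ}
    (hu : IsEuler A q dt u) (hK : ∀ n i, |A (u n) i| ≤ K) (n : ℕ) (i : ι) :
    |oddPow (u n i) (q - 1)| ≤ |oddPow (u 0 i) (q - 1)| + n * dt * K := by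
  induction n with
  | zero => simp
  | succ n ih =>
    have h := hu n i
    have h2 := hK (n + 1) i
    have h3 : |dt * A (u (n + 1)) i| ≤ dt * K := by
      rw [abs_mul, abs_of_pos hdt]
      exact mul_le_mul_of_nonneg_left h2 hdt.le
    have h4 := abs_sub (oddPow (u n i) (q - 1)) (dt * A (u (n + 1)) i)
    rw [← h, add_sub_cancel_right, h] at h4
    push_cast
    linarith

/-! ### Stability of approximate solutions -/

section Stability

set_option linter.unusedSectionVars false

variable {ι : Type*} [Fintype ι] {A : (ι → ℝ) →ₗ[ℝ] (ι → ℝ)}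

/-- `v` solves `d/dt v^(q-1) + A v = 0`, `v 0 = x₀`, in integrated form on `[0, T]`, up to an
error `η`. -/
structure IsApprox (A : (ι → ℝ) →ₗ[ℝ] (ι → ℝ)) (q T η : ℝ) (x₀ : ι → ℝ) (v : ℝ → ι → ℝ) :
    Prop where
  integrable : ∀ i, IntervalIntegrable (fun s => v s i) volume 0 T
  error : ∀ t ∈ Icc 0 T, ∀ i, |oddPow (v t i) (q - 1) -
    (oddPow (x₀ i) (q - 1) - A (fun k => ∫ s in (0 : ℝ)..t, v s k) i)| ≤ η

lemma IsApprox.mono {q T η : ℝ} {x₀ : ι → ℝ} {v : ℝ → ι → ℝ} (h : IsApprox A q T η x₀ v) {t : ℝ}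
    (ht : t ∈ Icc 0 T) : IsApprox A q t η x₀ v where
  integrable i := (h.integrable i).mono_set (by
    rw [uIcc_of_le ht.1, uIcc_of_le (ht.1.trans ht.2)]; exact Icc_subset_Icc_right ht.2)
  error s hs := h.error s ⟨hs.1, hs.2.trans ht.2⟩

/-- Product rule for absolutely continuous primitives. The integrands will be step functions, so it
is available only almost everywhere. -/
lemma integral_mul_primitive_add {f g : ℝ → ℝ} {T : ℝ} (hf : IntervalIntegrable f volume 0 T)
    (hg : IntervalIntegrable g volume 0 T) :
    ∫ t in (0 : ℝ)..T, (f t * (∫ s in (0 : ℝ)..t, g s) + (∫ s in (0 : ℝ)..t, f s) * g t) =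
      (∫ s in (0 : ℝ)..T, f s) * ∫ s in (0 : ℝ)..T, g s := by
  have h := (hf.absolutelyContinuousOnInterval_intervalIntegral left_mem_uIcc).integral_deriv_mul_eq_sub
    (hg.absolutelyContinuousOnInterval_intervalIntegral left_mem_uIcc)
  simp only [intervalIntegral.integral_same, mul_zero, sub_zero] at h
  rw [← h]
  refine intervalIntegral.integral_congr_ae ?_
  filter_upwards [hf.ae_hasDerivAt_integral, hg.ae_hasDerivAt_integral] with t h1 h2 ht
  have ht' := uIoc_subset_uIcc ht
  rw [(h1 ht' 0 left_mem_uIcc).deriv, (h2 ht' 0 left_mem_uIcc).deriv]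

/-- The chain rule for ⟨AF, F⟩ with F a primitive of f. Symmetry of A pairs the matrix entries so
that each one needs only the scalar product rule. -/
lemma IsPSD.energy_primitive (hA : IsPSD A) {f : ℝ → ι → ℝ} {T : ℝ}
    (hf : ∀ i, IntervalIntegrable (fun s => f s i) volume 0 T) :
    IntervalIntegrable (fun t => 2 * dotProduct (A fun k => ∫ s in (0 : ℝ)..t, f s k) (f t))
      volume 0 T ∧
    dotProduct (A fun k => ∫ s in (0 : ℝ)..T, f s k) (fun k => ∫ s in (0 : ℝ)..T, f s k) =
      ∫ t in (0 : ℝ)..T, 2 * dotProduct (A fun k => ∫ s in (0 : ℝ)..t, f s k) (f t) := by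
  classical
  set a : ι → ι → ℝ := fun i k => A (fun j => if k = j then 1 else 0) i with ha
  have hAa : ∀ x i, A x i = ∑ k, a i k * x k := fun x i => by
    rw [LinearMap.pi_apply_eq_sum_univ A x, Finset.sum_apply]
    refine Finset.sum_congr rfl fun k _ => ?_
    simp [ha, mul_comm]
  have hdot : ∀ x y, dotProduct (A x) y = ∑ i, ∑ k, a i k * (x k * y i) := fun x y => by
    simp_rw [dotProduct, hAa, Finset.sum_mul, mul_assoc]
  have hpoint : ∀ x y, 2 * dotProduct (A x) y = ∑ i, ∑ k, a i k * (y k * x i + x k * y i) :=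
    fun x y => by
      rw [two_mul]
      nth_rewrite 1 [hA.symm x y]
      simp_rw [hdot, ← Finset.sum_add_distrib, ← mul_add]
  have hc : ∀ i, ContinuousOn (fun t => ∫ s in (0 : ℝ)..t, f s i) (uIcc 0 T) := fun i =>
    intervalIntegral.continuousOn_primitive_interval' (hf i) left_mem_uIcc
  have hint : ∀ i k, IntervalIntegrable (fun t => f t k * (∫ s in (0 : ℝ)..t, f s i) +
      (∫ s in (0 : ℝ)..t, f s k) * f t i) volume 0 T := fun i k =>
    ((hf k).mul_continuousOn (hc i)).add ((hf i).continuousOn_mul (hc k))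
  have hsum : ∀ i, IntervalIntegrable (fun t => ∑ k, a i k * (f t k * (∫ s in (0 : ℝ)..t, f s i) +
      (∫ s in (0 : ℝ)..t, f s k) * f t i)) volume 0 T := fun i => by
    have := IntervalIntegrable.sum Finset.univ fun k (_ : k ∈ Finset.univ) =>
      (hint i k).const_mul (a i k)
    simpa only [Finset.sum_fn] using this
  simp_rw [hpoint]
  constructor
  · simpa only [Finset.sum_fn] using
      IntervalIntegrable.sum Finset.univ fun i (_ : i ∈ Finset.univ) => hsum i
  · rw [intervalIntegral.integral_finsetSum fun i _ => hsum i, hdot]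
    refine Finset.sum_congr rfl fun i _ => ?_
    rw [intervalIntegral.integral_finsetSum fun k _ => (hint i k).const_mul (a i k)]
    refine Finset.sum_congr rfl fun k _ => ?_
    rw [intervalIntegral.integral_const_mul, integral_mul_primitive_add (hf k) (hf i)]

/-- Test the difference of the integrated equations with v₁ - v₂: the power term has a favourable
sign, the A term is half the derivative of the energy of the primitive, and only the errors remain.
-/
lemma IsApprox.energy_sub_le (hA : IsPSD A) {q T η₁ η₂ R : ℝ} (hq : 1 < q) (hT : 0 ≤ T)
    {x₀ : ι → ℝ} {v₁ v₂ : ℝ → ι → ℝ} (h₁ : IsApprox A q T η₁ x₀ v₁)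
    (h₂ : IsApprox A q T η₂ x₀ v₂) (hR₁ : ∀ t ∈ Icc 0 T, ∀ i, |v₁ t i| ≤ R)
    (hR₂ : ∀ t ∈ Icc 0 T, ∀ i, |v₂ t i| ≤ R) :
    dotProduct (A fun k => ∫ s in (0 : ℝ)..T, (v₁ s k - v₂ s k))
      (fun k => ∫ s in (0 : ℝ)..T, (v₁ s k - v₂ s k)) ≤
      T * (Fintype.card ι * (4 * R * (η₁ + η₂))) := by
  have hf : ∀ i, IntervalIntegrable (fun s => (v₁ s - v₂ s) i) volume 0 T := fun i =>
    (h₁.integrable i).sub (h₂.integrable i)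
  obtain ⟨hi, he⟩ := hA.energy_primitive hf
  simp only [Pi.sub_apply] at hi he
  rw [he]
  calc _ ≤ ∫ _ in (0 : ℝ)..T, (Fintype.card ι * (4 * R * (η₁ + η₂)) : ℝ) := by
        refine intervalIntegral.integral_mono_on hT hi (by simp) fun t ht => ?_
        have hAt : (A fun k => ∫ s in (0 : ℝ)..t, (v₁ s k - v₂ s k)) =
            (A fun k => ∫ s in (0 : ℝ)..t, v₁ s k) - A fun k => ∫ s in (0 : ℝ)..t, v₂ s k := by
          rw [← map_sub]
          congr 1
          funext k
          exact intervalIntegral.integral_sub ((h₁.mono ht).integrable k)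
            ((h₂.mono ht).integrable k)
        rw [hAt, dotProduct, Finset.mul_sum, ← nsmul_eq_mul, ← Finset.card_univ,
          ← Finset.sum_const]
        refine Finset.sum_le_sum fun i _ => ?_
        have hm := oddPow_sub_mul_sub_nonneg (show 0 < q - 1 by linarith) (v₁ t i) (v₂ t i)
        have e1 := h₁.error t ht i
        have e2 := h₂.error t ht i
        have b1 := hR₁ t ht i
        have b2 := hR₂ t ht i
        simp only [Pi.sub_apply]
        set a₁ := A (fun k => ∫ s in (0 : ℝ)..t, v₁ s k) i
        set a₂ := A (fun k => ∫ s in (0 : ℝ)..t, v₂ s k) i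
        set d₁ := oddPow (v₁ t i) (q - 1) - (oddPow (x₀ i) (q - 1) - a₁) with hd₁
        set d₂ := oddPow (v₂ t i) (q - 1) - (oddPow (x₀ i) (q - 1) - a₂) with hd₂
        have hd : |d₁ - d₂| ≤ η₁ + η₂ := (abs_sub d₁ d₂).trans (add_le_add e1 e2)
        have hv : |v₁ t i - v₂ t i| ≤ 2 * R := (abs_sub _ _).trans (by linarith)
        have hprod : (d₁ - d₂) * (v₁ t i - v₂ t i) ≤ (η₁ + η₂) * (2 * R) :=
          (le_abs_self _).trans (by
            rw [abs_mul]
            exact mul_le_mul hd hv (abs_nonneg _) ((abs_nonneg _).trans hd))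
        -- The subtracted product is nonnegative by `hm` and is dropped. The constant 4 R is 2 from
        -- the energy identity times 2 R from `hv`.
        have e : (a₁ - a₂) * (v₁ t i - v₂ t i) = (d₁ - d₂) * (v₁ t i - v₂ t i) -
            (oddPow (v₁ t i) (q - 1) - oddPow (v₂ t i) (q - 1)) * (v₁ t i - v₂ t i) := by
          rw [hd₁, hd₂]; ring
        rw [e]
        linarith
    _ = _ := by rw [intervalIntegral.integral_const, sub_zero, smul_eq_mul]

/-- Approximate solutions with the same initial datum stay close. -/
lemma IsApprox.exists_abs_sub_le (hA : IsPSD A) {q : ℝ} (hq : 1 < q) :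
    ∃ C : ℝ, 0 ≤ C ∧ ∀ {T η₁ η₂ R : ℝ} {x₀ : ι → ℝ} {v₁ v₂ : ℝ → ι → ℝ},
      IsApprox A q T η₁ x₀ v₁ → IsApprox A q T η₂ x₀ v₂ →
      (∀ t ∈ Icc 0 T, ∀ i, |v₁ t i| ≤ R) → (∀ t ∈ Icc 0 T, ∀ i, |v₂ t i| ≤ R) →
      ∀ t ∈ Icc 0 T, ∀ i, |oddPow (v₁ t i) (q - 1) - oddPow (v₂ t i) (q - 1)| ≤
        η₁ + η₂ + √(C * (T * (R * (η₁ + η₂)))) := by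
  obtain ⟨C, hC0, hC⟩ := hA.exists_sq_apply_le
  refine ⟨C * (4 * Fintype.card ι), by positivity, ?_⟩
  intro T η₁ η₂ R x₀ v₁ v₂ h₁ h₂ hR₁ hR₂ t ht i
  have hsub : Icc 0 t ⊆ Icc 0 T := Icc_subset_Icc_right ht.2
  have hE := IsApprox.energy_sub_le hA hq ht.1 (h₁.mono ht) (h₂.mono ht)
    (fun s hs => hR₁ s (hsub hs)) (fun s hs => hR₂ s (hsub hs))
  have hη₁ : 0 ≤ η₁ := (abs_nonneg _).trans (h₁.error t ht i)
  have hη₂ : 0 ≤ η₂ := (abs_nonneg _).trans (h₂.error t ht i)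
  have hR : 0 ≤ R := (abs_nonneg _).trans (hR₁ t ht i)
  have hAt : (A fun k => ∫ s in (0 : ℝ)..t, (v₁ s k - v₂ s k)) i =
      A (fun k => ∫ s in (0 : ℝ)..t, v₁ s k) i - A (fun k => ∫ s in (0 : ℝ)..t, v₂ s k) i := by
    rw [← Pi.sub_apply, ← map_sub]
    refine congrFun (congrArg A (funext fun k => ?_)) i
    exact intervalIntegral.integral_sub ((h₁.mono ht).integrable k) ((h₂.mono ht).integrable k)
  -- The energy of the primitive of v₁ - v₂ bounds exactly the A term by which the two integrated
  -- equations differ.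
  have hs : |(A fun k => ∫ s in (0 : ℝ)..t, (v₁ s k - v₂ s k)) i| ≤
      √(C * (4 * Fintype.card ι) * (T * (R * (η₁ + η₂)))) := by
    refine Real.abs_le_sqrt ((hC _ i).trans ?_)
    calc _ ≤ C * (t * (Fintype.card ι * (4 * R * (η₁ + η₂)))) :=
          mul_le_mul_of_nonneg_left hE hC0
      _ ≤ C * (T * (Fintype.card ι * (4 * R * (η₁ + η₂)))) := by
          refine mul_le_mul_of_nonneg_left (mul_le_mul_of_nonneg_right ht.2 ?_) hC0
          positivity
      _ = _ := by ring
  rw [hAt] at hs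
  have e1 := abs_le.1 (h₁.error t ht i)
  have e2 := abs_le.1 (h₂.error t ht i)
  have e3 := abs_le.1 hs
  rw [abs_le]
  constructor <;> linarith [e1.1, e1.2, e2.1, e2.2, e3.1, e3.2]

/-! ### Step functions in time -/

lemma intervalIntegrable_step (u : ℕ → ℝ) (dt a b : ℝ) (hdt : 0 < dt) :
    IntervalIntegrable (fun t => u ⌈t / dt⌉₊) volume a b := by
  rw [intervalIntegrable_iff]
  refine Measure.integrableOn_of_bounded (M := ∑ j ∈ Finset.range (⌈max a b / dt⌉₊ + 1), |u j|)
    (by simp [uIoc]) ?_ ?_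
  · exact ((measurable_from_nat (f := u)).comp (Nat.measurable_ceil.comp
      (measurable_id.div_const dt))).aestronglyMeasurable
  · refine (ae_restrict_iff' measurableSet_uIoc).2 (Eventually.of_forall fun t ht => ?_)
    refine Finset.single_le_sum (f := fun j => |u j|) (fun j _ => abs_nonneg _)
      (Finset.mem_range.2 (Nat.lt_succ_of_le (Nat.ceil_mono ?_)))
    have : t ≤ max a b := ht.2
    gcongr

lemma ceil_div_eq {dt t : ℝ} (hdt : 0 < dt) {n : ℕ} (h1 : n * dt < t) (h2 : t ≤ (n + 1) * dt) :
    ⌈t / dt⌉₊ = n + 1 := by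
  rw [Nat.ceil_eq_iff (Nat.succ_ne_zero n)]
  refine ⟨?_, ?_⟩
  · rw [lt_div_iff₀ hdt]; simpa using h1
  · rw [div_le_iff₀ hdt]; simpa using h2

lemma integral_step {u : ℕ → ℝ} {dt t : ℝ} (hdt : 0 < dt) {n : ℕ} (h1 : n * dt ≤ t)
    (h2 : t ≤ (n + 1) * dt) :
    ∫ s in (n * dt)..t, u ⌈s / dt⌉₊ = (t - n * dt) * u (n + 1) := by
  have hc : ∫ _ in (n * dt)..t, u (n + 1) = (t - n * dt) * u (n + 1) := by simp
  rw [← hc]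
  refine intervalIntegral.integral_congr_uIoo fun s hs => ?_
  rw [uIoo_of_le h1] at hs
  simp only [ceil_div_eq hdt hs.1 (hs.2.le.trans h2)]

lemma IsEuler.oddPow_eq {q dt : ℝ} (hdt : 0 < dt) {u : ℕ → ι → ℝ} (hu : IsEuler A q dt u) (n : ℕ)
    (i : ι) : oddPow (u n i) (q - 1) = oddPow (u 0 i) (q - 1) -
      A (fun k => ∫ s in (0 : ℝ)..(n * dt), u ⌈s / dt⌉₊ k) i := by
  induction n with
  | zero =>
    have : (fun _ => 0 : ι → ℝ) = 0 := rfl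
    simp [this]
  | succ n ih =>
    have hint : (fun k => ∫ s in (0 : ℝ)..((n + 1 : ℕ) * dt), u ⌈s / dt⌉₊ k) =
        (fun k => ∫ s in (0 : ℝ)..(n * dt), u ⌈s / dt⌉₊ k) + dt • u (n + 1) := by
      funext k
      rw [← intervalIntegral.integral_add_adjacent_intervals
        (intervalIntegrable_step (fun m => u m k) dt 0 (n * dt) hdt)
        (intervalIntegrable_step (fun m => u m k) dt (n * dt) _ hdt),
        integral_step (u := fun m => u m k) hdt (by push_cast; nlinarith) (by simp)]
      simp only [Pi.add_apply, Pi.smul_apply, smul_eq_mul]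
      push_cast
      ring
    rw [hint, map_add, map_smul, Pi.add_apply, Pi.smul_apply, smul_eq_mul]
    linarith [hu n i]

lemma IsEuler.error_le {q dt K : ℝ} (hdt : 0 < dt) {u : ℕ → ι → ℝ} (hu : IsEuler A q dt u)
    (hK : ∀ n i, |A (u n) i| ≤ K) {t : ℝ} (ht : 0 ≤ t) (i : ι) :
    |oddPow (u ⌈t / dt⌉₊ i) (q - 1) - (oddPow (u 0 i) (q - 1) -
      A (fun k => ∫ s in (0 : ℝ)..t, u ⌈s / dt⌉₊ k) i)| ≤ dt * K := by
  have hK0 : 0 ≤ K := (abs_nonneg _).trans (hK 0 i)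
  rcases ht.eq_or_lt with rfl | ht
  · have : (fun _ => 0 : ι → ℝ) = 0 := rfl
    simpa [this] using mul_nonneg hdt.le hK0
  · obtain ⟨n, hn⟩ := Nat.exists_eq_succ_of_ne_zero (Nat.ceil_pos.2 (div_pos ht hdt)).ne'
    have hn' := (Nat.ceil_eq_iff (Nat.succ_ne_zero n)).1 hn
    rw [lt_div_iff₀ hdt, div_le_iff₀ hdt] at hn'
    have h1 : n * dt ≤ t := by simpa using hn'.1.le
    have h2 : t ≤ (n + 1) * dt := by simpa using hn'.2
    have hint : (fun k => ∫ s in (0 : ℝ)..t, u ⌈s / dt⌉₊ k) =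
        (fun k => ∫ s in (0 : ℝ)..(n * dt), u ⌈s / dt⌉₊ k) + (t - n * dt) • u (n + 1) := by
      funext k
      rw [← intervalIntegral.integral_add_adjacent_intervals
        (intervalIntegrable_step (fun m => u m k) dt 0 (n * dt) hdt)
        (intervalIntegrable_step (fun m => u m k) dt (n * dt) _ hdt),
        integral_step (u := fun m => u m k) hdt h1 h2]
      rfl
    rw [hn, hint, map_add, map_smul, Pi.add_apply, Pi.smul_apply, smul_eq_mul]
    -- The integrated equation is exact at grid times, so the residual at t is what is missing up to
    -- the next one.
    have e : oddPow (u n.succ i) (q - 1) - (oddPow (u 0 i) (q - 1) -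
        (A (fun k => ∫ s in (0 : ℝ)..(n * dt), u ⌈s / dt⌉₊ k) i +
          (t - n * dt) * A (u (n + 1)) i)) = -(((n + 1) * dt - t) * A (u (n + 1)) i) := by
      rw [Nat.succ_eq_add_one]
      linarith [hu n i, hu.oddPow_eq hdt n i]
    rw [e, abs_neg, abs_mul, abs_of_nonneg (by linarith)]
    exact mul_le_mul (by linarith) (hK _ i) (abs_nonneg _) hdt.le

lemma abs_le_of_abs_oddPow_le {q B x : ℝ} (hq : 1 < q) (h : |oddPow x (q - 1)| ≤ B) :
    |x| ≤ B ^ (1 / (q - 1)) := by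
  have hq1 : 0 < q - 1 := by linarith
  rw [abs_oddPow hq1] at h
  rw [one_div, Real.le_rpow_inv_iff_of_pos (abs_nonneg x) ((Real.rpow_nonneg (abs_nonneg x) _).trans h)
    hq1]
  exact h

lemma IsEuler.exists_isApprox (hA : IsPSD A) {q : ℝ} (hq : 1 < q) (x₀ : ι → ℝ) {T : ℝ}
    (hT : 0 ≤ T) :
    ∃ K R : ℝ, 0 ≤ K ∧ 0 ≤ R ∧ ∀ {dt : ℝ} {u : ℕ → ι → ℝ}, 0 < dt → dt ≤ 1 → IsEuler A q dt u →
      u 0 = x₀ → IsApprox A q T (dt * K) x₀ (fun t => u ⌈t / dt⌉₊) ∧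
        ∀ t ∈ Icc 0 T, ∀ i, |u ⌈t / dt⌉₊ i| ≤ R := by
  obtain ⟨K, hK0, hK⟩ := IsEuler.exists_abs_apply_le hA hq x₀
  have hB : 0 ≤ ∑ i, |oddPow (x₀ i) (q - 1)| + (T + 1) * K := by positivity
  -- T + 1 absorbs the rounding ⌈t / dt⌉ dt ≤ t + dt with dt ≤ 1.
  refine ⟨K, (∑ i, |oddPow (x₀ i) (q - 1)| + (T + 1) * K) ^ (1 / (q - 1)), hK0,
    Real.rpow_nonneg hB _, fun {dt u} hdt hdt1 hu h0 => ⟨⟨fun i =>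
      intervalIntegrable_step (fun m => u m i) dt 0 T hdt, fun t ht i => ?_⟩, fun t ht i => ?_⟩⟩
  · rw [← h0]
    exact hu.error_le hdt (hK hdt hu h0) ht.1 i
  · refine abs_le_of_abs_oddPow_le hq ((hu.abs_oddPow_le hdt (hK hdt hu h0) _ i).trans ?_)
    rw [h0]
    refine add_le_add (Finset.single_le_sum (f := fun i => |oddPow (x₀ i) (q - 1)|)
      (fun i _ => abs_nonneg _) (Finset.mem_univ i)) (mul_le_mul_of_nonneg_right ?_ hK0)
    have h1 := (Nat.ceil_lt_add_one (div_nonneg ht.1 hdt.le)).le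
    calc (⌈t / dt⌉₊ : ℝ) * dt ≤ (t / dt + 1) * dt := mul_le_mul_of_nonneg_right h1 hdt.le
      _ = t + dt := by field_simp
      _ ≤ T + 1 := add_le_add ht.2 hdt1

end Stability

/-! ### The limit of the implicit Euler steps -/

section Limit

set_option linter.unusedSectionVars false

variable {ι : Type*} [Fintype ι] {A : (ι → ℝ) →ₗ[ℝ] (ι → ℝ)}

/-- `v` solves `d/dt v^(q-1) + A v = 0`, `v 0 = x₀`, in integrated form on `[0, ∞)`. -/
structure IsExact (A : (ι → ℝ) →ₗ[ℝ] (ι → ℝ)) (q : ℝ) (x₀ : ι → ℝ) (v : ℝ → ι → ℝ) : Prop where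
  continuousOn : ∀ i, ContinuousOn (fun t => v t i) (Ici 0)
  eq : ∀ t, 0 ≤ t → ∀ i, oddPow (v t i) (q - 1) =
    oddPow (x₀ i) (q - 1) - A (fun k => ∫ s in (0 : ℝ)..t, v s k) i

lemma IsExact.isApprox {q : ℝ} {x₀ : ι → ℝ} {v : ℝ → ι → ℝ} (h : IsExact A q x₀ v) {T : ℝ}
    (hT : 0 ≤ T) : IsApprox A q T 0 x₀ v where
  integrable i := ContinuousOn.intervalIntegrable ((h.continuousOn i).mono (by
    rw [uIcc_of_le hT]; exact Icc_subset_Ici_self))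
  error t ht i := by rw [h.eq t ht.1 i, sub_self, abs_zero]

lemma IsExact.exists_abs_le {q : ℝ} {x₀ : ι → ℝ} {v : ℝ → ι → ℝ} (h : IsExact A q x₀ v) (T : ℝ) :
    ∃ R : ℝ, 0 ≤ R ∧ ∀ t ∈ Icc 0 T, ∀ i, |v t i| ≤ R := by
  have hb : ∀ i, ∃ R : ℝ, ∀ t ∈ Icc 0 T, |v t i| ≤ R := fun i => by
    simpa using isCompact_Icc.exists_bound_of_continuousOn
      ((h.continuousOn i).mono (Icc_subset_Ici_self : Icc (0 : ℝ) T ⊆ Ici 0))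
  choose R hR using hb
  refine ⟨∑ i, |R i|, Finset.sum_nonneg fun i _ => abs_nonneg _, fun t ht i =>
    ((hR i t ht).trans (le_abs_self _)).trans
      (Finset.single_le_sum (f := fun i => |R i|) (fun i _ => abs_nonneg _) (Finset.mem_univ i))⟩

lemma IsExact.initial {q : ℝ} (hq : 1 < q) {x₀ : ι → ℝ} {v : ℝ → ι → ℝ} (h : IsExact A q x₀ v) :
    v 0 = x₀ := by
  funext i
  have h0 := h.eq 0 le_rfl i
  have : (fun _ => 0 : ι → ℝ) = 0 := rfl
  simp only [intervalIntegral.integral_same, this, map_zero, Pi.zero_apply, sub_zero] at h0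
  exact (strictMono_oddPow (by linarith)).injective h0

/-- The stability estimate with both errors zero. -/
lemma IsExact.unique (hA : IsPSD A) {q : ℝ} (hq : 1 < q) {x₀ : ι → ℝ} {v w : ℝ → ι → ℝ}
    (hv : IsExact A q x₀ v) (hw : IsExact A q x₀ w) {t : ℝ} (ht : 0 ≤ t) : v t = w t := by
  obtain ⟨C, -, hC⟩ := IsApprox.exists_abs_sub_le hA hq
  obtain ⟨R₁, -, hR₁⟩ := hv.exists_abs_le t
  obtain ⟨R₂, -, hR₂⟩ := hw.exists_abs_le t
  funext i
  have h := hC (hv.isApprox ht) (hw.isApprox ht)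
    (fun s hs j => (hR₁ s hs j).trans (le_max_left R₁ R₂))
    (fun s hs j => (hR₂ s hs j).trans (le_max_right R₁ R₂)) t ⟨ht, le_rfl⟩ i
  simp only [add_zero, mul_zero, Real.sqrt_zero] at h
  exact (strictMono_oddPow (by linarith)).injective
    (sub_eq_zero.1 (abs_eq_zero.1 (le_antisymm h (abs_nonneg _))))

/-- Convergence of the odd powers implies uniform convergence. -/
lemma exists_delta_oddPow {r : ℝ} (hr : 0 < r) (R : ℝ) {ε : ℝ} (hε : 0 < ε) :
    ∃ δ > 0, ∀ x y : ℝ, |x| ≤ R → |y| ≤ R → |oddPow x r - oddPow y r| < δ → |x - y| < ε := by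
  have hr' : 0 < 1 / r := by positivity
  have hu := isCompact_Icc.uniformContinuousOn_of_continuous
    (continuous_oddPow hr').continuousOn (s := Icc (-(R ^ r)) (R ^ r))
  rw [Metric.uniformContinuousOn_iff] at hu
  obtain ⟨δ, hδ, h⟩ := hu ε hε
  have hinv : ∀ x, oddPow (oddPow x r) (1 / r) = x := fun x => by
    rw [oddPow_oddPow hr hr', mul_one_div_cancel hr.ne', oddPow_one]
  have hmem : ∀ x, |x| ≤ R → oddPow x r ∈ Icc (-(R ^ r)) (R ^ r) := fun x hx => by
    rw [mem_Icc, ← abs_le, abs_oddPow hr]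
    exact Real.rpow_le_rpow (abs_nonneg x) hx hr.le
  refine ⟨δ, hδ, fun x y hx hy hxy => ?_⟩
  have := h _ (hmem x hx) _ (hmem y hy) (by rwa [Real.dist_eq])
  rwa [Real.dist_eq, hinv, hinv] at this

/-- Stability compares powers. The inverse power need not be Lipschitz but is uniformly continuous
on bounded sets, and the bounds on u and v do not depend on dt. -/
lemma IsExact.exists_delta_euler (hA : IsPSD A) {q : ℝ} (hq : 1 < q) {x₀ : ι → ℝ}
    {v : ℝ → ι → ℝ} (hv : IsExact A q x₀ v) {T : ℝ} (hT : 0 ≤ T) {ε : ℝ} (hε : 0 < ε) :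
    ∃ δ > 0, ∀ {dt : ℝ} {u : ℕ → ι → ℝ}, 0 < dt → dt < δ → IsEuler A q dt u → u 0 = x₀ →
      ∀ t ∈ Icc 0 T, ∀ i, |u ⌈t / dt⌉₊ i - v t i| < ε := by
  obtain ⟨C, -, hC⟩ := IsApprox.exists_abs_sub_le hA hq
  obtain ⟨K, R₁, -, -, hK⟩ := IsEuler.exists_isApprox hA hq x₀ hT
  obtain ⟨R₂, -, hR₂⟩ := hv.exists_abs_le T
  obtain ⟨η, hη, h⟩ := exists_delta_oddPow (show 0 < q - 1 by linarith) (max R₁ R₂) hε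
  have hlim : Tendsto (fun dt : ℝ => dt * K + 0 + √(C * (T * (max R₁ R₂ * (dt * K + 0)))))
      (𝓝 0) (𝓝 0) := by
    have hc : Continuous fun dt : ℝ =>
      dt * K + 0 + √(C * (T * (max R₁ R₂ * (dt * K + 0)))) := by fun_prop
    simpa using hc.tendsto 0
  obtain ⟨δ, hδ, hball⟩ := Metric.eventually_nhds_iff.1 (hlim.eventually (gt_mem_nhds hη))
  refine ⟨min δ 1, by positivity, fun {dt u} hdt hlt hu h0 t ht i => ?_⟩
  obtain ⟨ha, hR₁⟩ := hK hdt (hlt.le.trans (min_le_right _ _)) hu h0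
  refine h _ _ ((hR₁ t ht i).trans (le_max_left _ _)) ((hR₂ t ht i).trans (le_max_right _ _)) ?_
  refine (hC ha (hv.isApprox hT) (fun s hs j => (hR₁ s hs j).trans (le_max_left R₁ R₂))
    (fun s hs j => (hR₂ s hs j).trans (le_max_right R₁ R₂)) t ht i).trans_lt (hball ?_)
  rw [Real.dist_eq, sub_zero, abs_of_pos hdt]
  exact hlt.trans_le (min_le_left _ _)

lemma IsPSD.exists_isExact (hA : IsPSD A) {q : ℝ} (hq : 1 < q) (x₀ : ι → ℝ) :
    ∃ v : ℝ → ι → ℝ, IsExact A q x₀ v := by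
  have hq1 : 0 < q - 1 := by linarith
  set d : ℕ → ℝ := fun n => 1 / ((n : ℝ) + 1) with hd
  have hd0 : ∀ n, 0 < d n := fun n => Nat.one_div_pos_of_nat
  have hd1 : ∀ n, d n ≤ 1 := fun n => by
    rw [hd, div_le_one (by positivity)]; linarith [n.cast_nonneg (α := ℝ)]
  have hdanti : Antitone d := fun m n h => Nat.one_div_le_one_div h
  have hdlim : Tendsto d atTop (𝓝 0) := tendsto_one_div_add_atTop_nhds_zero_nat
  choose u hu0 hu using fun n => hA.exists_isEuler hq (hd0 n) x₀
  obtain ⟨C, hC0, hC⟩ := IsApprox.exists_abs_sub_le hA hq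
  -- Stability bounds the distance of two interpolants by their errors, so no compactness or
  -- subsequence is needed.
  have hcauchy : ∀ t, 0 ≤ t → ∀ i,
      CauchySeq fun n => oddPow (u n ⌈t / d n⌉₊ i) (q - 1) := fun t ht i => by
    obtain ⟨K, R, hK0, hR0, hK⟩ := IsEuler.exists_isApprox hA hq x₀ ht
    refine cauchySeq_of_le_tendsto_0
      (fun n => d n * K + d n * K + √(C * (t * (R * (d n * K + d n * K)))))
      (fun n m N hn hm => ?_) ?_
    · obtain ⟨a1, b1⟩ := hK (hd0 n) (hd1 n) (hu n) (hu0 n)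
      obtain ⟨a2, b2⟩ := hK (hd0 m) (hd1 m) (hu m) (hu0 m)
      have := hdanti hn
      have := hdanti hm
      rw [Real.dist_eq]
      refine (hC a1 a2 b1 b2 t ⟨ht, le_rfl⟩ i).trans ?_
      gcongr
    · have hc : Continuous fun x : ℝ =>
        x * K + x * K + √(C * (t * (R * (x * K + x * K)))) := by fun_prop
      have h0 := (hc.tendsto 0).comp hdlim
      simp only [zero_mul, add_zero, mul_zero, Real.sqrt_zero] at h0
      exact h0
  have hconv : ∀ t i, ∃ y : ℝ, 0 ≤ t → Tendsto (fun n => u n ⌈t / d n⌉₊ i) atTop (𝓝 y) :=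
    fun t i => by
      by_cases ht : 0 ≤ t
      · obtain ⟨y, hy⟩ := cauchySeq_tendsto_of_complete (hcauchy t ht i)
        refine ⟨oddPow y (1 / (q - 1)), fun _ => ?_⟩
        have := ((continuous_oddPow (show 0 < 1 / (q - 1) by positivity)).tendsto y).comp hy
        refine this.congr fun n => ?_
        rw [Function.comp_apply, oddPow_oddPow hq1 (by positivity),
          mul_one_div_cancel hq1.ne', oddPow_one]
      · exact ⟨0, fun h => absurd h ht⟩
  choose v hv using hconv
  -- The uniform bound R gives integrability of the pointwise limit and dominated convergence.
  have hint : ∀ T, 0 ≤ T → ∀ i, IntervalIntegrable (fun s => v s i) volume 0 T ∧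
      Tendsto (fun n => ∫ s in (0 : ℝ)..T, u n ⌈s / d n⌉₊ i) atTop
        (𝓝 (∫ s in (0 : ℝ)..T, v s i)) := fun T hT i => by
    obtain ⟨K, R, hK0, hR0, hK⟩ := IsEuler.exists_isApprox hA hq x₀ hT
    have hmem : ∀ {s}, s ∈ uIoc 0 T → s ∈ Icc 0 T := fun hs => by
      rw [uIoc_of_le hT] at hs; exact Ioc_subset_Icc_self hs
    have hmeas : ∀ n, AEStronglyMeasurable (fun s => u n ⌈s / d n⌉₊ i)
        (volume.restrict (uIoc 0 T)) := fun n =>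
      (intervalIntegrable_step (fun m => u n m i) (d n) 0 T (hd0 n)).aestronglyMeasurable_restrict_uIoc
    have hlim : ∀ᵐ s ∂volume.restrict (uIoc 0 T),
        Tendsto (fun n => u n ⌈s / d n⌉₊ i) atTop (𝓝 (v s i)) :=
      (ae_restrict_iff' measurableSet_uIoc).2
        (Eventually.of_forall fun s hs => hv s i (hmem hs).1)
    constructor
    · rw [intervalIntegrable_iff]
      have : IsFiniteMeasure (volume.restrict (uIoc 0 T)) := ⟨by simp [uIoc]⟩
      refine Integrable.of_bound (aestronglyMeasurable_of_tendsto_ae atTop hmeas hlim) R ?_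
      refine (ae_restrict_iff' measurableSet_uIoc).2 (Eventually.of_forall fun s hs => ?_)
      exact le_of_tendsto ((hv s i (hmem hs).1).norm) (Eventually.of_forall fun n =>
        (hK (hd0 n) (hd1 n) (hu n) (hu0 n)).2 s (hmem hs) i)
    · refine intervalIntegral.tendsto_integral_filter_of_dominated_convergence (fun _ => R)
        (Eventually.of_forall hmeas) (Eventually.of_forall fun n => Eventually.of_forall
          fun s hs => (hK (hd0 n) (hd1 n) (hu n) (hu0 n)).2 s (hmem hs) i) (by simp)
        ((ae_restrict_iff' measurableSet_uIoc).1 hlim)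
  have hAc : Continuous A := A.continuous_of_finiteDimensional
  have heq : ∀ t, 0 ≤ t → ∀ i, oddPow (v t i) (q - 1) =
      oddPow (x₀ i) (q - 1) - A (fun k => ∫ s in (0 : ℝ)..t, v s k) i := fun t ht i => by
    obtain ⟨K, R, hK0, hR0, hK⟩ := IsEuler.exists_isApprox hA hq x₀ ht
    have h1 : Tendsto (fun n => oddPow (u n ⌈t / d n⌉₊ i) (q - 1) - (oddPow (x₀ i) (q - 1) -
        A (fun k => ∫ s in (0 : ℝ)..t, u n ⌈s / d n⌉₊ k) i)) atTop
        (𝓝 (oddPow (v t i) (q - 1) - (oddPow (x₀ i) (q - 1) -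
          A (fun k => ∫ s in (0 : ℝ)..t, v s k) i))) := by
      refine (((continuous_oddPow hq1).tendsto _).comp (hv t i ht)).sub
        (tendsto_const_nhds.sub ?_)
      exact ((((continuous_apply i).comp hAc).tendsto _).comp
        (tendsto_pi_nhds.2 fun k => (hint t ht k).2))
    have h2 : Tendsto (fun n => oddPow (u n ⌈t / d n⌉₊ i) (q - 1) - (oddPow (x₀ i) (q - 1) -
        A (fun k => ∫ s in (0 : ℝ)..t, u n ⌈s / d n⌉₊ k) i)) atTop (𝓝 0) := by
      refine squeeze_zero_norm (a := fun n => d n * K) (fun n =>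
        (hK (hd0 n) (hd1 n) (hu n) (hu0 n)).1.error t ⟨ht, le_rfl⟩ i) ?_
      simpa using hdlim.mul_const K
    exact sub_eq_zero.1 (tendsto_nhds_unique h1 h2)
  -- Continuity comes afterwards from the equation: v^(q-1) is a constant minus A of primitives, and
  -- v is its inverse power.
  refine ⟨v, fun i => ?_, heq⟩
  have hprim : ∀ k, ContinuousOn (fun t => ∫ s in (0 : ℝ)..t, v s k) (Ici 0) := fun k t ht => by
    have ht0 : (0 : ℝ) ≤ t := ht
    have hc := intervalIntegral.continuousOn_primitive_interval'
      (hint (t + 1) (by linarith) k).1 left_mem_uIcc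
    rw [uIcc_of_le (by linarith)] at hc
    refine (hc t ⟨ht0, by linarith⟩).mono_of_mem_nhdsWithin ?_
    rw [mem_nhdsWithin]
    exact ⟨Iio (t + 1), isOpen_Iio, by simp, fun s hs => ⟨hs.2, hs.1.le⟩⟩
  have hy : ContinuousOn (fun t => oddPow (v t i) (q - 1)) (Ici 0) := by
    refine ContinuousOn.congr (f := fun t => oddPow (x₀ i) (q - 1) -
      A (fun k => ∫ s in (0 : ℝ)..t, v s k) i) (continuousOn_const.sub
        (((continuous_apply i).comp hAc).comp_continuousOn (continuousOn_pi.2 hprim)))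
        fun t ht => heq t ht i
  refine ((continuous_oddPow (show 0 < 1 / (q - 1) by positivity)).comp_continuousOn hy).congr
    fun t _ => ?_
  rw [Function.comp_apply, oddPow_oddPow hq1 (by positivity), mul_one_div_cancel hq1.ne',
    oddPow_one]

/-- The energy inequality for difference quotients. -/
lemma IsExact.energy_le (hA : IsPSD A) {q : ℝ} (hq : 1 < q) {x₀ : ι → ℝ} {v : ℝ → ι → ℝ}
    (hv : IsExact A q x₀ v) {s t : ℝ} (hs : 0 ≤ s) (hst : s ≤ t) :
    4 / (q * Real.conjExponent q) * ∑ i, (oddPow (v t i) (q / 2) - oddPow (v s i) (q / 2)) ^ 2 ≤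
      (t - s) * (dotProduct (A (v s)) (v s) / 2 - dotProduct (A (v t)) (v t) / 2) := by
  set d : ℕ → ℝ := fun n => 1 / ((n : ℝ) + 1) with hd
  have hd0 : ∀ n, 0 < d n := fun n => Nat.one_div_pos_of_nat
  have hdlim : Tendsto d atTop (𝓝 0) := tendsto_one_div_add_atTop_nhds_zero_nat
  choose u hu0 hu using fun n => hA.exists_isEuler hq (hd0 n) x₀
  have hconv : ∀ τ, 0 ≤ τ → Tendsto (fun n => u n ⌈τ / d n⌉₊) atTop (𝓝 (v τ)) := fun τ hτ => by
    refine tendsto_pi_nhds.2 fun i => Metric.tendsto_nhds.2 fun ε hε => ?_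
    obtain ⟨δ, hδ, h⟩ := hv.exists_delta_euler hA hq hτ hε
    filter_upwards [hdlim.eventually (gt_mem_nhds hδ)] with n hn
    exact h (hd0 n) hn (hu n) (hu0 n) τ ⟨hτ, le_rfl⟩ i
  have hAc : Continuous A := A.continuous_of_finiteDimensional
  have hE : Continuous fun x : ι → ℝ => dotProduct (A x) x / 2 :=
    (continuous_finsetSum _ fun i _ =>
      ((continuous_apply i).comp hAc).mul (continuous_apply i)).div_const 2
  have hw : Continuous fun p : (ι → ℝ) × (ι → ℝ) => 4 / (q * Real.conjExponent q) *
      ∑ i, (oddPow (p.1 i) (q / 2) - oddPow (p.2 i) (q / 2)) ^ 2 := by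
    refine continuous_const.mul (continuous_finsetSum _ fun i _ => Continuous.pow (Continuous.sub
      ((continuous_oddPow (by linarith)).comp ((continuous_apply i).comp continuous_fst))
      ((continuous_oddPow (by linarith)).comp ((continuous_apply i).comp continuous_snd))) 2)
  have ht := hs.trans hst
  have hlhs := (hw.tendsto (v t, v s)).comp ((hconv t ht).prodMk_nhds (hconv s hs))
  have hrhs : Tendsto (fun n => (t - s + d n) *
      (dotProduct (A (u n ⌈s / d n⌉₊)) (u n ⌈s / d n⌉₊) / 2 -
        dotProduct (A (u n ⌈t / d n⌉₊)) (u n ⌈t / d n⌉₊) / 2)) atTop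
      (𝓝 ((t - s + 0) * (dotProduct (A (v s)) (v s) / 2 - dotProduct (A (v t)) (v t) / 2))) :=
    (hdlim.const_add (t - s)).mul
      (((hE.tendsto _).comp (hconv s hs)).sub ((hE.tendsto _).comp (hconv t ht)))
  rw [add_zero] at hrhs
  refine le_of_tendsto_of_tendsto' hlhs hrhs fun n => ?_
  have hle : ⌈s / d n⌉₊ ≤ ⌈t / d n⌉₊ :=
    Nat.ceil_mono (div_le_div_of_nonneg_right hst (hd0 n).le)
  -- The number of steps between the two rounded times is at most (t - s)/d n + 1; the extra one is
  -- the term d n in `hrhs`, which vanishes in the limit.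
  have h := (hu n).energy_steps hA hq (hd0 n) ⌈s / d n⌉₊ (⌈t / d n⌉₊ - ⌈s / d n⌉₊)
  rw [Nat.add_sub_cancel' hle] at h
  refine h.trans (mul_le_mul_of_nonneg_right ?_ ?_)
  · have h1 := (Nat.ceil_lt_add_one (div_nonneg ht (hd0 n).le)).le
    have h2 := Nat.le_ceil (s / d n)
    rw [Nat.cast_sub hle]
    calc ((⌈t / d n⌉₊ : ℝ) - ⌈s / d n⌉₊) * d n ≤ (t / d n + 1 - s / d n) * d n :=
          mul_le_mul_of_nonneg_right (by linarith) (hd0 n).le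
      _ = t - s + d n := by have := (hd0 n).ne'; field_simp; ring
  · have := (hu n).energy_antitone hA hq (hd0 n) hle
    simp only at this
    linarith

end Limit

/-! ### Weak derivatives on an interval -/

lemma eq_zero_of_tsupport_subset {φ : ℝ → ℝ} {T : ℝ} (h : tsupport φ ⊆ Ioo 0 T) {t : ℝ}
    (ht : t ∉ Ioo 0 T) : φ t = 0 :=
  image_eq_zero_of_notMem_tsupport fun h' => ht (h h')

lemma setIntegral_Ioo_eq {T : ℝ} (hT : 0 ≤ T) (f : ℝ → ℝ) :
    ∫ t in Ioo 0 T, f t = ∫ t in (0 : ℝ)..T, f t := by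
  rw [intervalIntegral.integral_of_le hT, integral_Ioc_eq_integral_Ioo]

lemma memLp_of_continuousOn {T : ℝ} {f : ℝ → ℝ} (hf : ContinuousOn f (Icc 0 T)) (p : ENNReal) :
    MemLp f p (volume.restrict (Ioo 0 T)) := by
  obtain ⟨C, hC⟩ := isCompact_Icc.exists_bound_of_continuousOn hf
  have : IsFiniteMeasure (volume.restrict (Ioo 0 T)) := ⟨by simp⟩
  refine MemLp.of_bound ((hf.mono Ioo_subset_Icc_self).aestronglyMeasurable measurableSet_Ioo) C ?_
  exact (ae_restrict_iff' measurableSet_Ioo).2 (Eventually.of_forall fun t ht =>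
    hC t (Ioo_subset_Icc_self ht))

lemma locallyIntegrableOn_of_intervalIntegrable {T : ℝ} (hT : 0 ≤ T) {f : ℝ → ℝ}
    (hf : IntervalIntegrable f volume 0 T) : LocallyIntegrableOn f (Ioo 0 T) :=
  (((intervalIntegrable_iff_integrableOn_Ioc_of_le hT).1 hf).mono_set
    Ioo_subset_Ioc_self).locallyIntegrableOn

lemma HasWeakDeriv.of_hasDerivAt {T : ℝ} (hT : 0 ≤ T) {f g : ℝ → ℝ}
    (hf : ContinuousOn f (Icc 0 T)) (hg : ContinuousOn g (Icc 0 T))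
    (hfg : ∀ t ∈ Ioo 0 T, HasDerivAt f (g t) t) : HasWeakDeriv T f g := by
  rw [← uIcc_of_le hT] at hf hg
  refine ⟨locallyIntegrableOn_of_intervalIntegrable hT hf.intervalIntegrable,
    locallyIntegrableOn_of_intervalIntegrable hT hg.intervalIntegrable, fun φ hφ _ hsupp => ?_⟩
  have hφ1 : ContDiff ℝ 1 φ := hφ.of_le (by exact_mod_cast le_top)
  rw [setIntegral_Ioo_eq hT, setIntegral_Ioo_eq hT,
    intervalIntegral.integral_mul_deriv_eq_deriv_mul_of_hasDerivAt hf hφ.continuous.continuousOn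
    (by rwa [min_eq_left hT, max_eq_right hT])
    (fun x _ => (hφ1.differentiable one_ne_zero x).hasDerivAt) hg.intervalIntegrable
    ((hφ1.continuous_deriv le_rfl).intervalIntegrable _ _),
    eq_zero_of_tsupport_subset hsupp (t := 0) (by simp),
    eq_zero_of_tsupport_subset hsupp (t := T) (by simp)]
  ring

lemma MemW1.of_hasDerivAt {T : ℝ} (hT : 0 ≤ T) {f g : ℝ → ℝ}
    (hf : ContinuousOn f (Icc 0 T)) (hg : ContinuousOn g (Icc 0 T))
    (hfg : ∀ t ∈ Ioo 0 T, HasDerivAt f (g t) t) (p : ENNReal) : MemW1 p T f :=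
  ⟨memLp_of_continuousOn hf p, g, memLp_of_continuousOn hg p,
    HasWeakDeriv.of_hasDerivAt hT hf hg hfg⟩

lemma HasWeakDeriv.of_absolutelyContinuous {T : ℝ} (hT : 0 ≤ T) {f : ℝ → ℝ}
    (hf : AbsolutelyContinuousOnInterval f 0 T) : HasWeakDeriv T f (deriv f) := by
  refine ⟨locallyIntegrableOn_of_intervalIntegrable hT hf.continuousOn.intervalIntegrable,
    locallyIntegrableOn_of_intervalIntegrable hT hf.intervalIntegrable_deriv,
    fun φ hφ _ hsupp => ?_⟩
  have hφ1 : ContDiff ℝ 1 φ := hφ.of_le (by exact_mod_cast le_top)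
  rw [setIntegral_Ioo_eq hT, setIntegral_Ioo_eq hT,
    hf.integral_mul_deriv_eq_deriv_mul hφ1.contDiffOn.absolutelyContinuousOnInterval,
    eq_zero_of_tsupport_subset hsupp (t := 0) (by simp),
    eq_zero_of_tsupport_subset hsupp (t := T) (by simp)]
  ring

/-- A smooth function of zero mean with compact support in `(0, T)` is the derivative of another
one. -/
lemma exists_test_primitive {T : ℝ} {ψ : ℝ → ℝ} (hψ : ContDiff ℝ ((⊤ : ℕ∞) : WithTop ℕ∞) ψ)
    (hc : HasCompactSupport ψ) (hs : tsupport ψ ⊆ Ioo 0 T) (h0 : ∫ t, ψ t = 0) :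
    ∃ χ : ℝ → ℝ, ContDiff ℝ ((⊤ : ℕ∞) : WithTop ℕ∞) χ ∧ HasCompactSupport χ ∧
      tsupport χ ⊆ Ioo 0 T ∧ deriv χ = ψ := by
  have hd : ∀ x, HasDerivAt (fun x => ∫ t in (0 : ℝ)..x, ψ t) (ψ x) x := fun x =>
    intervalIntegral.integral_hasDerivAt_right (hψ.continuous.intervalIntegrable _ _)
      (hψ.continuous.stronglyMeasurableAtFilter _ _) hψ.continuous.continuousAt
  have hderiv : deriv (fun x => ∫ t in (0 : ℝ)..x, ψ t) = ψ := funext fun x => (hd x).deriv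
  -- The primitive vanishes left of the hull of the support, and right of it by the zero mean.
  -- Compactness keeps this hull inside (0, T); for empty support any a > 0 and b < T will do.
  obtain ⟨a, b, ha, hb, hK⟩ : ∃ a b : ℝ, 0 < a ∧ b < T ∧ tsupport ψ ⊆ Icc a b := by
    rcases (tsupport ψ).eq_empty_or_nonempty with he | hne
    · exact ⟨1, T - 1, one_pos, by linarith, by simp [he]⟩
    · have hK : IsCompact (tsupport ψ) := hc
      exact ⟨sInf (tsupport ψ), sSup (tsupport ψ), (hs (hK.sInf_mem hne)).1,
        (hs (hK.sSup_mem hne)).2, fun x hx =>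
        ⟨csInf_le hK.bddBelow hx, le_csSup hK.bddAbove hx⟩⟩
  have hz : ∀ x, x ∉ Icc a b → ψ x = 0 := fun x hx =>
    image_eq_zero_of_notMem_tsupport fun h => hx (hK h)
  have hsupp : tsupport (fun x => ∫ t in (0 : ℝ)..x, ψ t) ⊆ Icc a b := by
    refine closure_minimal (fun x hx => ?_) isClosed_Icc
    by_contra hx'
    refine hx ?_
    rw [mem_Icc, not_and_or, not_le, not_le] at hx'
    rcases hx' with hx' | hx'
    · simp only
      rw [intervalIntegral.integral_congr (g := fun _ => 0) (fun t ht => hz t fun h => ?_)]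
      · simp
      · rcases le_total 0 x with h' | h'
        · rw [uIcc_of_le h'] at ht; linarith [ht.2, h.1]
        · rw [uIcc_of_ge h'] at ht; linarith [ht.2, h.1]
    · simp only
      rw [intervalIntegral.integral_eq_integral_of_support_subset, h0]
      intro t ht
      by_contra htx
      refine ht (hz t fun h => htx ⟨ha.trans_le h.1, h.2.trans hx'.le⟩)
  refine ⟨_, contDiff_infty_iff_deriv.2 ⟨fun x => (hd x).differentiableAt, ?_⟩,
    HasCompactSupport.of_support_subset_isCompact isCompact_Icc
      ((subset_tsupport _).trans hsupp),
    hsupp.trans fun x hx => ⟨ha.trans_le hx.1, hx.2.trans_lt hb⟩, hderiv⟩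
  rw [hderiv]
  exact hψ

/-- The du Bois-Reymond lemma. -/
lemma exists_eq_const_of_integral_mul_deriv_eq_zero {T : ℝ} (hT : 0 < T) {F : ℝ → ℝ}
    (hF : ContinuousOn F (Icc 0 T))
    (h : ∀ φ : ℝ → ℝ, ContDiff ℝ ((⊤ : ℕ∞) : WithTop ℕ∞) φ → HasCompactSupport φ →
      tsupport φ ⊆ Ioo 0 T → ∫ t in Ioo 0 T, F t * deriv φ t = 0) :
    ∀ t ∈ Icc 0 T, F t = F 0 := by
  -- A bump of unit mass supported in [T/4, 3T/4]; testing F against it yields the only possible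
  -- constant c.
  let ρ : ContDiffBump (T / 2) := ⟨T / 8, T / 4, by positivity, by linarith⟩
  set φ₀ : ℝ → ℝ := ρ.normed volume with hφ₀
  have hρ : ContDiff ℝ ((⊤ : ℕ∞) : WithTop ℕ∞) φ₀ := ρ.contDiff_normed
  have hρs : tsupport φ₀ ⊆ Ioo 0 T := by
    rw [hφ₀, ρ.tsupport_normed_eq, Real.closedBall_eq_Icc]
    exact fun x hx => ⟨by linarith [hx.1, show ρ.rOut = T / 4 from rfl],
      by linarith [hx.2, show ρ.rOut = T / 4 from rfl]⟩
  have hρc : HasCompactSupport φ₀ := ρ.hasCompactSupport_normed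
  set c : ℝ := ∫ t in Ioo 0 T, F t * φ₀ t with hc
  have hint : ∀ g : ℝ → ℝ, Continuous g → IntegrableOn (fun t => F t * g t) (Ioo 0 T) :=
    fun g hg => ((hF.mul hg.continuousOn).integrableOn_Icc).mono_set Ioo_subset_Icc_self
  have hae : ∀ᵐ x : ℝ, x ∈ Ioo 0 T → F x - c = 0 := by
    refine isOpen_Ioo.ae_eq_zero_of_integral_contDiff_smul_eq_zero
      (((hF.sub continuousOn_const).integrableOn_Icc.mono_set
        Ioo_subset_Icc_self).locallyIntegrableOn) fun g hg hgc hgs => ?_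
    have hgi : Integrable g := hg.continuous.integrable_of_hasCompactSupport hgc
    have hρi : Integrable φ₀ := hρ.continuous.integrable_of_hasCompactSupport hρc
    -- Subtracting (∫ g) φ₀ removes the mean of g, so the hypothesis applies to a primitive.
    obtain ⟨χ, h1, h2, h3, h4⟩ := exists_test_primitive (T := T)
      (ψ := fun t => g t - (∫ s, g s) * φ₀ t) (hg.sub (contDiff_const.mul hρ))
      (hgc.sub hρc.mul_left)
      ((tsupport_sub _ _).trans (union_subset hgs ((tsupport_mul_subset_right).trans hρs)))
      (by rw [integral_sub hgi (hρi.const_mul _), integral_const_mul, ρ.integral_normed,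
        mul_one, sub_self])
    have h5 := h χ h1 h2 h3
    have hout : ∀ x, x ∉ Ioo 0 T → g x • (F x - c) = 0 := fun x hx => by
      rw [eq_zero_of_tsupport_subset hgs hx, zero_smul]
    have hgI : ∫ t in Ioo 0 T, g t = ∫ t, g t :=
      setIntegral_eq_integral_of_forall_compl_eq_zero fun x hx =>
        eq_zero_of_tsupport_subset hgs hx
    rw [← setIntegral_eq_integral_of_forall_compl_eq_zero hout]
    have e1 : ∫ t in Ioo 0 T, F t * deriv χ t =
        (∫ t in Ioo 0 T, F t * g t) - (∫ s, g s) * c := by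
      rw [hc, ← integral_const_mul, ← integral_sub (hint g hg.continuous)
        ((hint φ₀ hρ.continuous).const_mul _), h4]
      exact integral_congr_ae (Eventually.of_forall fun t => by simp only; ring)
    have e2 : ∫ t in Ioo 0 T, g t • (F t - c) =
        (∫ t in Ioo 0 T, F t * g t) - (∫ s, g s) * c := by
      rw [← hgI, ← integral_mul_const, ← integral_sub (hint g hg.continuous)
        (hgi.integrableOn.mul_const _)]
      exact integral_congr_ae (Eventually.of_forall fun t => by simp only [smul_eq_mul]; ring)
    rw [e2, ← e1, h5]
  have heq : EqOn F (fun _ => c) (Ioo 0 T) :=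
    Measure.eqOn_open_of_ae_eq ((ae_restrict_iff' measurableSet_Ioo).2
      (hae.mono fun x hx h => sub_eq_zero.1 (hx h))) isOpen_Ioo (hF.mono Ioo_subset_Icc_self)
      continuousOn_const
  have heq' : EqOn F (fun _ => c) (Icc 0 T) :=
    heq.of_subset_closure hF continuousOn_const Ioo_subset_Icc_self (closure_Ioo hT.ne).ge
  intro t ht
  rw [heq' ht, heq' (left_mem_Icc.2 hT.le)]

/-- The difference of f and the primitive of g has weak derivative zero; continuity extends the
identity to the endpoints. -/
lemma HasWeakDeriv.eq_add_integral {T : ℝ} (hT : 0 < T) {f g : ℝ → ℝ}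
    (hf : ContinuousOn f (Icc 0 T)) (hg : ContinuousOn g (Icc 0 T)) (h : HasWeakDeriv T f g)
    {t : ℝ} (ht : t ∈ Icc 0 T) : f t = f 0 + ∫ s in (0 : ℝ)..t, g s := by
  have hgi : IntervalIntegrable g volume 0 T :=
    ContinuousOn.intervalIntegrable (by rwa [uIcc_of_le hT.le])
  have hG : ContinuousOn (fun t => ∫ s in (0 : ℝ)..t, g s) (Icc 0 T) := by
    have := intervalIntegral.continuousOn_primitive_interval' hgi left_mem_uIcc
    rwa [uIcc_of_le hT.le] at this
  have hG' : HasWeakDeriv T (fun t => ∫ s in (0 : ℝ)..t, g s) g :=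
    HasWeakDeriv.of_hasDerivAt hT.le hG hg fun t ht =>
      intervalIntegral.integral_hasDerivAt_right
        (hgi.mono_set (by
          rw [uIcc_of_le ht.1.le, uIcc_of_le hT.le]; exact Icc_subset_Icc_right ht.2.le))
        (hg.mono Ioo_subset_Icc_self |>.stronglyMeasurableAtFilter isOpen_Ioo t ht)
        (hg.continuousAt (Icc_mem_nhds ht.1 ht.2))
  have hconst := exists_eq_const_of_integral_mul_deriv_eq_zero hT (hf.sub hG)
    fun φ hφ hφc hφs => by
      have hi : ∀ {u : ℝ → ℝ}, ContinuousOn u (Icc 0 T) →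
          IntegrableOn (fun t => u t * deriv φ t) (Ioo 0 T) := fun hu =>
        ((hu.mul (hφ.continuous_deriv (by simp)).continuousOn).integrableOn_Icc).mono_set
          Ioo_subset_Icc_self
      simp only [Pi.sub_apply, sub_mul]
      rw [integral_sub (hi hf) (hi hG), h.2.2 φ hφ hφc hφs, hG'.2.2 φ hφ hφc hφs, sub_self]
  have := hconst t ht
  simp only [Pi.sub_apply, intervalIntegral.integral_same] at this
  linarith

/-! ### Absolute continuity from an energy inequality -/

/-- The increments of a monotone continuous function over disjoint intervals. -/
lemma sum_sub_le_of_monotone {ψ : ℝ → ℝ} (hm : Monotone ψ) (hc : Continuous ψ) {a b : ℝ}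
    (hab : a ≤ b) {E : ℕ × (ℕ → ℝ × ℝ)}
    (hE : E ∈ AbsolutelyContinuousOnInterval.disjWithin a b) :
    ∑ i ∈ Finset.range E.1, |ψ (E.2 i).1 - ψ (E.2 i).2| ≤ ψ b - ψ a := by
  -- The increments are Stieltjes measures of disjoint intervals, so additivity replaces any
  -- ordering of them.
  let S : StieltjesFunction ℝ := ⟨ψ, hm, fun x => hc.continuousWithinAt⟩
  have h1 : ∀ i, ENNReal.ofReal |ψ (E.2 i).1 - ψ (E.2 i).2| =
      S.measure (uIoc (E.2 i).1 (E.2 i).2) := fun i => by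
    rcases le_total (E.2 i).1 (E.2 i).2 with h | h
    · rw [uIoc_of_le h, S.measure_Ioc, abs_of_nonpos (sub_nonpos.2 (hm h)), neg_sub]
    · rw [uIoc_of_ge h, S.measure_Ioc, abs_of_nonneg (sub_nonneg.2 (hm h))]
  have h2 : ENNReal.ofReal (∑ i ∈ Finset.range E.1, |ψ (E.2 i).1 - ψ (E.2 i).2|) ≤
      ENNReal.ofReal (ψ b - ψ a) := by
    rw [ENNReal.ofReal_sum_of_nonneg fun i _ => abs_nonneg _, Finset.sum_congr rfl fun i _ => h1 i,
      ← measure_biUnion_finset hE.2 fun i _ => measurableSet_uIoc]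
    calc _ ≤ S.measure (Ioc a b) := measure_mono (by
          rw [← uIoc_of_le hab]
          exact AbsolutelyContinuousOnInterval.biUnion_uIoc_subset_of_mem_disjWithin
            (n := E.1) (I := E.2) hE)
      _ = _ := S.measure_Ioc a b
  exact (ENNReal.ofReal_le_ofReal_iff (sub_nonneg.2 (hm hab))).1 h2

/-- Cauchy-Schwarz over disjoint intervals: (∑ |Δw|)² ≤ (∑ |Δt|/c)(∑ |Δψ|), and the last factor is
at most ψ b - ψ a. -/
lemma absolutelyContinuous_of_sq_sub_le {w ψ : ℝ → ℝ} (hm : Monotone ψ) (hc : Continuous ψ)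
    {c : ℝ} (hc0 : 0 < c)
    (h : ∀ s t, 0 ≤ s → s ≤ t → c * (w t - w s) ^ 2 ≤ (t - s) * (ψ t - ψ s)) {a b : ℝ}
    (ha : 0 ≤ a) (hab : a ≤ b) : AbsolutelyContinuousOnInterval w a b := by
  have habs : ∀ s t, 0 ≤ s → 0 ≤ t → c * |w s - w t| ^ 2 ≤ |s - t| * |ψ s - ψ t| :=
    fun s t hs ht => by
      rcases le_total s t with hst | hst
      · have := h s t hs hst
        rw [sq_abs, abs_of_nonpos (sub_nonpos.2 hst), abs_of_nonpos (sub_nonpos.2 (hm hst))]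
        linarith
      · have := h t s ht hst
        rw [sq_abs, abs_of_nonneg (sub_nonneg.2 hst), abs_of_nonneg (sub_nonneg.2 (hm hst))]
        linarith
  rw [absolutelyContinuousOnInterval_iff]
  intro ε hε
  set D := ψ b - ψ a with hD
  have hD0 : 0 ≤ D := sub_nonneg.2 (hm hab)
  -- D + 1 rather than D, since ψ may be constant.
  refine ⟨c * ε ^ 2 / (D + 1), by positivity, fun E hE hlt => ?_⟩
  have hpos : ∀ i ∈ Finset.range E.1, 0 ≤ (E.2 i).1 ∧ 0 ≤ (E.2 i).2 := fun i hi => by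
    have := hE.1 i hi
    rw [uIcc_of_le hab] at this
    exact ⟨ha.trans this.1.1, ha.trans this.2.1⟩
  simp only [Real.dist_eq] at hlt ⊢
  have hcs := Finset.sum_sq_le_sum_mul_sum_of_sq_le_mul (Finset.range E.1)
    (r := fun i => |w (E.2 i).1 - w (E.2 i).2|) (f := fun i => |(E.2 i).1 - (E.2 i).2| / c)
    (g := fun i => |ψ (E.2 i).1 - ψ (E.2 i).2|) (fun i _ => by positivity)
    (fun i _ => by positivity) (fun i hi => by
      have := habs _ _ (hpos i hi).1 (hpos i hi).2
      rw [div_mul_eq_mul_div, le_div_iff₀ hc0]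
      linarith)
  have hψ := sum_sub_le_of_monotone hm hc hab hE
  rw [← Finset.sum_div] at hcs
  have hL : 0 ≤ ∑ i ∈ Finset.range E.1, |(E.2 i).1 - (E.2 i).2| :=
    Finset.sum_nonneg fun i _ => abs_nonneg _
  refine lt_of_pow_lt_pow_left₀ 2 hε.le (hcs.trans_lt ?_)
  calc _ ≤ (∑ i ∈ Finset.range E.1, |(E.2 i).1 - (E.2 i).2|) / c * D :=
        mul_le_mul_of_nonneg_left hψ (by positivity)
    _ ≤ (∑ i ∈ Finset.range E.1, |(E.2 i).1 - (E.2 i).2|) / c * (D + 1) :=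
        mul_le_mul_of_nonneg_left (by linarith) (by positivity)
    _ < c * ε ^ 2 / (D + 1) / c * (D + 1) := by gcongr
    _ = ε ^ 2 := by field_simp

/-- Integrated form of the energy inequality for difference quotients. -/
lemma integral_sq_deriv_le {ι : Type*} [Fintype ι] {w : ℝ → ι → ℝ} {ψ : ℝ → ℝ}
    (hm : Monotone ψ) (hc : Continuous ψ) {c : ℝ} (hc0 : 0 < c)
    (h : ∀ s t, 0 ≤ s → s ≤ t → c * ∑ i, (w t i - w s i) ^ 2 ≤ (t - s) * (ψ t - ψ s))
    {a b : ℝ} (ha : 0 ≤ a) (hab : a ≤ b) :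
    (∀ i, AbsolutelyContinuousOnInterval (fun t => w t i) a b) ∧
    (∀ i, IntervalIntegrable (fun t => deriv (fun t => w t i) t ^ 2) volume a b) ∧
    c * ∫ t in a..b, ∑ i, deriv (fun t => w t i) t ^ 2 ≤ ψ b - ψ a := by
  have hac : ∀ i, AbsolutelyContinuousOnInterval (fun t => w t i) a b := fun i =>
    absolutelyContinuous_of_sq_sub_le hm hc hc0 (fun s t hs hst => le_trans
      (mul_le_mul_of_nonneg_left (Finset.single_le_sum (f := fun i => (w t i - w s i) ^ 2)
        (fun i _ => sq_nonneg _) (Finset.mem_univ i)) hc0.le) (h s t hs hst)) ha hab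
  have hψi : IntervalIntegrable (deriv ψ) volume a b :=
    (hm.monotoneOn _).intervalIntegrable_deriv
  -- Divide the increment inequality by (s - t)² and let s decrease to t.
  have hae : ∀ᵐ t : ℝ, t ∈ uIoc a b → c * ∑ i, deriv (fun t => w t i) t ^ 2 ≤ deriv ψ t := by
    filter_upwards [ae_all_iff.2 fun i => (hac i).ae_differentiableAt, hm.ae_differentiableAt]
      with t h1 h2 ht
    have ht0 : 0 ≤ t := by
      rw [uIoc_of_le hab] at ht; exact ha.trans ht.1.le
    have hsl : ∀ {f : ℝ → ℝ}, DifferentiableAt ℝ f t →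
        Tendsto (slope f t) (𝓝[>] t) (𝓝 (deriv f t)) := fun hf =>
      (hasDerivAt_iff_tendsto_slope.1 hf.hasDerivAt).mono_left
        (nhdsWithin_mono t fun x hx => ne_of_gt hx)
    refine le_of_tendsto_of_tendsto (((tendsto_finsetSum Finset.univ fun i _ =>
      (hsl (h1 i (uIoc_subset_uIcc ht))).pow 2)).const_mul c) (hsl h2) ?_
    filter_upwards [self_mem_nhdsWithin] with s hs
    have hst : 0 < s - t := sub_pos.2 hs
    simp only [slope_def_field, div_pow, ← Finset.sum_div]
    rw [← mul_div_assoc, div_le_div_iff₀ (by positivity) hst]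
    have := h t s ht0 (le_of_lt hs)
    nlinarith
  have hsq : ∀ i, IntervalIntegrable (fun t => deriv (fun t => w t i) t ^ 2) volume a b :=
    fun i => by
      refine IntervalIntegrable.mono_fun' (hψi.div_const c)
        ((measurable_deriv _).pow_const 2).aestronglyMeasurable ?_
      refine (ae_restrict_iff' measurableSet_uIoc).2 (hae.mono fun t ht htm => ?_)
      simp only
      rw [Real.norm_of_nonneg (sq_nonneg _), le_div_iff₀ hc0, mul_comm]
      refine le_trans ?_ (ht htm)
      exact mul_le_mul_of_nonneg_left (Finset.single_le_sum
        (f := fun i => deriv (fun t => w t i) t ^ 2) (fun i _ => sq_nonneg _)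
        (Finset.mem_univ i)) hc0.le
  refine ⟨hac, hsq, ?_⟩
  rw [← intervalIntegral.integral_const_mul]
  have hsum : IntervalIntegrable (fun t => ∑ i, deriv (fun t => w t i) t ^ 2) volume a b := by
    have := IntervalIntegrable.sum Finset.univ fun i (_ : i ∈ Finset.univ) => hsq i
    simpa only [Finset.sum_fn] using this
  calc _ ≤ ∫ t in a..b, deriv ψ t := by
        refine intervalIntegral.integral_mono_ae_restrict hab (hsum.const_mul c) hψi ?_
        have h0 : ∀ᵐ t : ℝ, t ≠ a := by simp [ae_iff]
        refine (ae_restrict_iff' measurableSet_Icc).2 ?_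
        filter_upwards [hae, h0] with t ht hta htm
        refine ht ?_
        rw [uIoc_of_le hab]
        exact ⟨lt_of_le_of_ne htm.1 (Ne.symm hta), htm.2⟩
    _ ≤ ψ b - ψ a := by
        -- ψ is only monotone, so the integral of its derivative may be smaller than its increment.
        have := (hm.monotoneOn (uIcc a b)).intervalIntegral_deriv_mem_uIcc
        rw [uIcc_of_le (sub_nonneg.2 (hm hab))] at this
        exact this.2

/-! ### Regularity of solutions -/

section Regularity

variable {ι : Type*} [Fintype ι] {A : (ι → ℝ) →ₗ[ℝ] (ι → ℝ)}

lemma map_intervalIntegral_apply {f : ℝ → ι → ℝ} {T : ℝ}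
    (hf : ∀ k, IntervalIntegrable (fun s => f s k) volume 0 T) (i : ι) :
    A (fun k => ∫ s in (0 : ℝ)..T, f s k) i = ∫ s in (0 : ℝ)..T, A (f s) i := by
  classical
  obtain ⟨a, ha⟩ : ∃ a : ι → ℝ, ∀ x, A x i = ∑ k, x k * a k :=
    ⟨fun k => A (fun j => if k = j then 1 else 0) i, fun x => by
      rw [LinearMap.pi_apply_eq_sum_univ A x, Finset.sum_apply]
      rfl⟩
  simp_rw [ha]
  rw [intervalIntegral.integral_finsetSum fun k _ => (hf k).mul_const _]
  simp_rw [intervalIntegral.integral_mul_const]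

/-- An exact solution, extended by its initial value to negative times. -/
lemma IsPSD.exists_continuous_isExact (hA : IsPSD A) {q : ℝ} (hq : 1 < q) (x₀ : ι → ℝ) :
    ∃ v : ℝ → ι → ℝ, IsExact A q x₀ v ∧ Continuous v ∧ ∀ t, v (max t 0) = v t := by
  obtain ⟨v, hv⟩ := hA.exists_isExact hq x₀
  have hc : Continuous fun t => v (max t 0) := continuous_pi fun i =>
    (hv.continuousOn i).comp_continuous (continuous_id.max continuous_const)
      fun t => le_max_right t 0
  refine ⟨fun t => v (max t 0), ⟨fun i => ((continuous_apply i).comp hc).continuousOn,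
    fun t ht i => ?_⟩, hc, fun t => by simp⟩
  simp only [max_eq_left ht, hv.eq t ht i]
  refine congrArg _ (congrFun (congrArg A (funext fun k =>
    intervalIntegral.integral_congr fun s hs => ?_)) i)
  rw [uIcc_of_le ht] at hs
  simp only [max_eq_left hs.1]

variable {q : ℝ} {x₀ : ι → ℝ} {v : ℝ → ι → ℝ}

lemma continuous_map_apply (hc : Continuous v) (i : ι) : Continuous fun t => A (v t) i :=
  (continuous_apply i).comp (A.continuous_of_finiteDimensional.comp hc)

lemma IsExact.hasDerivAt (hv : IsExact A q x₀ v) (hc : Continuous v) {t : ℝ} (ht : 0 < t)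
    (i : ι) : HasDerivAt (fun t => oddPow (v t i) (q - 1)) (-A (v t) i) t := by
  have hci := continuous_map_apply (A := A) hc i
  have h := (intervalIntegral.integral_hasDerivAt_right (hci.intervalIntegrable 0 t)
    (hci.stronglyMeasurableAtFilter _ _) hci.continuousAt).const_sub (oddPow (x₀ i) (q - 1))
  refine h.congr_of_eventuallyEq ?_
  filter_upwards [eventually_gt_nhds ht] with s hs
  have hint : ∀ k, IntervalIntegrable (fun r => v r k) volume 0 s := fun k =>
    ((continuous_apply k).comp hc).intervalIntegrable 0 s
  rw [hv.eq s hs.le i, map_intervalIntegral_apply hint]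

/-- Here v^q is the power q/(q-1) > 1 of v^(q-1), hence differentiable also where v vanishes. For
q/2 the exponent q/(2(q-1)) is below 1 when q > 2. -/
lemma IsExact.hasDerivAt_oddPow (hq : 1 < q) (hv : IsExact A q x₀ v) (hc : Continuous v) {t : ℝ}
    (ht : 0 < t) (i : ι) : HasDerivAt (fun t => oddPow (v t i) q)
      (q / (q - 1) * |oddPow (v t i) (q - 1)| ^ (q / (q - 1) - 1) * -A (v t) i) t := by
  have hq1 : 0 < q - 1 := by linarith
  have h1 : 1 < q / (q - 1) := by rw [lt_div_iff₀ hq1]; linarith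
  refine ((FracScheme.hasDerivAt_oddPow h1 (oddPow (v t i) (q - 1))).comp t
    (hv.hasDerivAt hc ht i)).congr_of_eventuallyEq (Eventually.of_forall fun s => ?_)
  simp only [Function.comp_apply]
  rw [oddPow_oddPow hq1 (by linarith), mul_div_cancel₀ _ hq1.ne']

/-- With y = v^(q-1), |v|^q = |y|^q', whose derivative in y is q' y^(q'-1) = q' v. -/
lemma IsExact.hasDerivAt_abs_rpow (hq : 1 < q) (hv : IsExact A q x₀ v) (hc : Continuous v)
    {t : ℝ} (ht : 0 < t) (i : ι) :
    HasDerivAt (fun t => |v t i| ^ q) (Real.conjExponent q * (v t i * -A (v t) i)) t := by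
  have hq1 : 0 < q - 1 := by linarith
  have h1 : 1 < Real.conjExponent q := (Real.HolderConjugate.conjExponent hq).symm.lt
  have h := (hasDerivAt_abs_rpow_div h1 (oddPow (v t i) (q - 1))).comp t (hv.hasDerivAt hc ht i)
  have h2 := h.const_mul (Real.conjExponent q)
  have e : Real.conjExponent q - 1 = 1 / (q - 1) := by
    rw [Real.conjExponent]; field_simp; ring
  rw [e, oddPow_oddPow hq1 (by positivity), mul_one_div_cancel hq1.ne', oddPow_one] at h2
  refine h2.congr_of_eventuallyEq (Eventually.of_forall fun s => ?_)
  simp only [Function.comp_apply]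
  rw [mul_div_cancel₀ _ (by linarith), abs_oddPow hq1, ← Real.rpow_mul (abs_nonneg _),
    Real.conjExponent, mul_div_cancel₀ _ hq1.ne']

lemma IsExact.energy_antitone (hA : IsPSD A) (hq : 1 < q) (hv : IsExact A q x₀ v) {s t : ℝ}
    (hs : 0 ≤ s) (hst : s ≤ t) : dotProduct (A (v t)) (v t) ≤ dotProduct (A (v s)) (v s) := by
  rcases hst.eq_or_lt with rfl | hlt
  · rfl
  · have h := hv.energy_le hA hq hs hst
    have h' : 0 ≤ 4 / (q * Real.conjExponent q) *
        ∑ i, (oddPow (v t i) (q / 2) - oddPow (v s i) (q / 2)) ^ 2 :=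
      mul_nonneg (energy_coeff_pos hq).le (Finset.sum_nonneg fun i _ => sq_nonneg _)
    have := nonneg_of_mul_nonneg_right (h'.trans h) (sub_pos.2 hlt)
    linarith

lemma IsExact.integral_energy (hA : IsPSD A) (hq : 1 < q) (hv : IsExact A q x₀ v)
    (hc : Continuous v) (hmax : ∀ t, v (max t 0) = v t) {a b : ℝ} (ha : 0 ≤ a) (hab : a ≤ b) :
    (∀ i, AbsolutelyContinuousOnInterval (fun t => oddPow (v t i) (q / 2)) a b) ∧
    (∀ i, IntervalIntegrable (fun t => deriv (fun t => oddPow (v t i) (q / 2)) t ^ 2)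
      volume a b) ∧
    4 / (q * Real.conjExponent q) *
        (∫ t in a..b, ∑ i, deriv (fun t => oddPow (v t i) (q / 2)) t ^ 2) +
      dotProduct (A (v b)) (v b) / 2 ≤ dotProduct (A (v a)) (v a) / 2 := by
  have hψc : Continuous fun t => -(dotProduct (A (v t)) (v t) / 2) :=
    ((continuous_finsetSum _ fun i _ => (continuous_map_apply hc i).mul
      ((continuous_apply i).comp hc)).div_const 2).neg
  -- By `hmax` the solution is frozen for t ≤ 0, so minus the energy is monotone on the whole line.
  have hψm : Monotone fun t => -(dotProduct (A (v t)) (v t) / 2) := fun s t hst => by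
    have := hv.energy_antitone hA hq (le_max_right s 0) (max_le_max_right 0 hst)
    rw [hmax, hmax] at this
    simp only
    linarith
  obtain ⟨h1, h2, h3⟩ := integral_sq_deriv_le (w := fun t i => oddPow (v t i) (q / 2)) hψm hψc
    (energy_coeff_pos hq) (fun s t hs hst => by
      have := hv.energy_le hA hq hs hst
      linarith) ha hab
  exact ⟨h1, h2, by linarith⟩

end Regularity

/-! ### The schemes on the lattice -/

section Lattice

variable {θ h q : ℝ} {M : ℕ} {u0 : ℤ → ℝ}

lemma isPSD_lap (h0 : 0 < θ) (h1 : θ < 1) (hh : 0 < h) (M : ℕ) : IsPSD (lap θ h M) :=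
  ⟨lap_symm θ h, lap_nonneg h0 h1 hh⟩

lemma extend_mem_discreteX (h0 : 0 < θ) (h1 : θ < 1) (hh : 0 < h) (x : Node M → ℝ) :
    extend x ∈ discreteX θ h M :=
  ⟨fun _ => extend_of_lt x, (hasSum_gagliardo h0 h1 hh fun _ => extend_of_lt x).summable⟩

/-- A node is either interior, or the extension by zero vanishes there. -/
lemma node_cases (M : ℕ) (i : ℤ) :
    (∃ k : Node M, (k : ℤ) = i) ∨ ∀ x : Node M → ℝ, extend x i = 0 := by
  rcases le_or_gt |i| (M : ℤ) with hi | hi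
  · exact Or.inl ⟨⟨i, mem_nodes.2 hi⟩, rfl⟩
  · exact Or.inr fun x => extend_of_lt x hi

lemma fracLap_eq_lap (h0 : 0 < θ) (h1 : θ < 1) {f : ℤ → ℝ}
    (hf : ∀ i : ℤ, (M : ℤ) + 1 ≤ |i| → f i = 0) (i : Node M) :
    fracLap θ h f i = lap θ h M (toNode M f) i := by
  rw [← fracLap_extend h0 h1, extend_toNode fun i hi => hf i (Int.add_one_le_iff.2 hi)]

lemma IsFDSolution.isEuler (h0 : 0 < θ) (h1 : θ < 1) {dt : ℝ} (hdt : 0 < dt)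
    {u : ℕ → ℤ → ℝ} (hu : IsFDSolution θ h q M u0 dt u) :
    IsEuler (lap θ h M) q dt (fun n => toNode M (u n)) ∧ toNode M (u 0) = toNode M u0 := by
  refine ⟨fun n i => ?_, funext fun i => hu.initial i (mem_nodes.1 i.2)⟩
  have e := hu.equation n i (mem_nodes.1 i.2)
  rw [fracLap_eq_lap h0 h1 (hu.boundary (n + 1))] at e
  have e' : oddPow (u (n + 1) i) (q - 1) - oddPow (u n i) (q - 1) +
      dt * lap θ h M (toNode M (u (n + 1))) i = 0 := by
    field_simp at e
    linarith
  simp only [toNode] at e' ⊢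
  linarith

lemma IsEuler.isFDSolution (h0 : 0 < θ) (h1 : θ < 1) {dt : ℝ} (hdt : 0 < dt)
    {U : ℕ → Node M → ℝ} (hU : IsEuler (lap θ h M) q dt U) (hU0 : U 0 = toNode M u0) :
    IsFDSolution θ h q M u0 dt (fun n => extend (U n)) where
  equation n i hi := by
    obtain ⟨k, rfl⟩ : ∃ k : Node M, (k : ℤ) = i := ⟨⟨i, mem_nodes.2 hi⟩, rfl⟩
    rw [fracLap_extend h0 h1, extend_coe, extend_coe, ← hU n k]
    field_simp
    ring
  boundary n i hi := extend_of_lt _ (Int.add_one_le_iff.1 hi)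
  initial i hi := by
    obtain ⟨k, rfl⟩ : ∃ k : Node M, (k : ℤ) = i := ⟨⟨i, mem_nodes.2 hi⟩, rfl⟩
    simp only [extend_coe, hU0, toNode]

lemma IsFDSolution.unique (h0 : 0 < θ) (h1 : θ < 1) (hh : 0 < h) (hq : 1 < q) {dt : ℝ}
    (hdt : 0 < dt) {u u' : ℕ → ℤ → ℝ} (hu : IsFDSolution θ h q M u0 dt u)
    (hu' : IsFDSolution θ h q M u0 dt u') : u = u' := by
  obtain ⟨e, i⟩ := hu.isEuler h0 h1 hdt
  obtain ⟨e', i'⟩ := hu'.isEuler h0 h1 hdt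
  have := e.unique (isPSD_lap h0 h1 hh M) hq hdt e' (i.trans i'.symm)
  funext n
  rw [← extend_toNode fun i hi => hu.boundary n i (Int.add_one_le_iff.2 hi),
    ← extend_toNode fun i hi => hu'.boundary n i (Int.add_one_le_iff.2 hi)]
  exact congrArg extend (congrFun this n)

lemma existsUnique_isFDSolution (h0 : 0 < θ) (h1 : θ < 1) (hh : 0 < h) (hq : 1 < q) {dt : ℝ}
    (hdt : 0 < dt) : ∃! u : ℕ → ℤ → ℝ, IsFDSolution θ h q M u0 dt u := by
  obtain ⟨U, hU0, hU⟩ := (isPSD_lap h0 h1 hh M).exists_isEuler hq hdt (toNode M u0)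
  exact ⟨_, hU.isFDSolution h0 h1 hdt hU0, fun u hu =>
    hu.unique h0 h1 hh hq hdt (hU.isFDSolution h0 h1 hdt hU0)⟩

/-- Continuity of w makes the weak derivative a continuous function of time, so the weak equation
can be integrated from 0. This transfers uniqueness to (SD). -/
lemma IsSDSolution.isExact (h0 : 0 < θ) (h1 : θ < 1) (hq : 1 < q) {w : ℝ → ℤ → ℝ}
    (hw : IsSDSolution θ h q M u0 w) :
    IsExact (lap θ h M) q (toNode M u0) (fun t => toNode M (w t)) where
  continuousOn i := hw.continuousOn i
  eq t ht i := by
    -- The longer interval has positive length even when t = 0.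
    have hT : 0 < t + 1 := by linarith
    have hsub : Icc 0 (t + 1) ⊆ Ici 0 := Icc_subset_Ici_self
    have hcont : ContinuousOn (fun s => toNode M (w s)) (Ici 0) :=
      continuousOn_pi.2 fun k => hw.continuousOn k
    have hlap : ContinuousOn (fun s => -lap θ h M (toNode M (w s)) i) (Ici 0) :=
      (((continuous_apply i).comp (lap θ h M).continuous_of_finiteDimensional).comp_continuousOn
        hcont).neg
    have hfrac : ∀ s ∈ Ici (0 : ℝ), -fracLap θ h (w s) i = -lap θ h M (toNode M (w s)) i :=
      fun s hs => by rw [fracLap_eq_lap h0 h1 fun j hj => hw.boundary j hj s hs]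
    have hw' := (hw.equation i (mem_nodes.1 i.2) (t + 1) hT).eq_add_integral hT
      (((continuous_oddPow (by linarith)).comp_continuousOn (hw.continuousOn i)).mono hsub)
      ((hlap.congr hfrac).mono hsub) ⟨ht, by linarith⟩
    simp only [Function.comp_apply] at hw'
    have hint : ∀ k : Node M, IntervalIntegrable (fun s => toNode M (w s) k) volume 0 t :=
      fun k => ContinuousOn.intervalIntegrable
        ((hw.continuousOn k).mono (by rw [uIcc_of_le ht]; exact Icc_subset_Ici_self))
    rw [intervalIntegral.integral_congr (g := fun s => -lap θ h M (toNode M (w s)) i) fun s hs =>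
      hfrac s (by rw [uIcc_of_le ht] at hs; exact hs.1), intervalIntegral.integral_neg,
      ← map_intervalIntegral_apply hint,
      hw.initial i (mem_nodes.1 i.2), ← sub_eq_add_neg] at hw'
    exact hw'

variable {v : ℝ → Node M → ℝ}

lemma hasWeakDeriv_zero {T : ℝ} (hT : 0 ≤ T) : HasWeakDeriv T (fun _ => 0) (fun _ => 0) :=
  HasWeakDeriv.of_hasDerivAt hT continuousOn_const continuousOn_const
    fun t _ => hasDerivAt_const t 0

lemma memW1_zero {T : ℝ} (hT : 0 ≤ T) (p : ENNReal) : MemW1 p T (fun _ => 0) :=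
  MemW1.of_hasDerivAt hT continuousOn_const continuousOn_const (fun t _ => hasDerivAt_const t 0) p

lemma IsExact.isSDSolution (h0 : 0 < θ) (h1 : θ < 1) (hq : 1 < q)
    (hv : IsExact (lap θ h M) q (toNode M u0) v) (hc : Continuous v) :
    IsSDSolution θ h q M u0 (fun t => extend (v t)) := by
  have hw : ∀ k : Node M, Continuous fun t => oddPow (v t k) (q - 1) := fun k =>
    (continuous_oddPow (by linarith)).comp ((continuous_apply k).comp hc)
  refine ⟨fun i => ?_, fun i T hT => ?_, fun i hi T hT => ?_, fun i hi t _ =>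
    extend_of_lt _ (Int.add_one_le_iff.1 hi), fun i hi => ?_⟩
  · rcases node_cases M i with ⟨k, rfl⟩ | hz
    · simp only [extend_coe]
      exact ((continuous_apply k).comp hc).continuousOn
    · simp only [hz]
      exact continuousOn_const
  · rcases node_cases M i with ⟨k, rfl⟩ | hz
    · simp only [extend_coe]
      exact MemW1.of_hasDerivAt hT.le (hw k).continuousOn
        (continuous_map_apply hc k).neg.continuousOn (fun t ht => hv.hasDerivAt hc ht.1 k) 1
    · simp only [hz, oddPow_zero]
      exact memW1_zero hT.le 1
  · obtain ⟨k, rfl⟩ : ∃ k : Node M, (k : ℤ) = i := ⟨⟨i, mem_nodes.2 hi⟩, rfl⟩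
    simp only [extend_coe, fracLap_extend h0 h1]
    exact HasWeakDeriv.of_hasDerivAt hT.le (hw k).continuousOn
        (continuous_map_apply hc k).neg.continuousOn (fun t ht => hv.hasDerivAt hc ht.1 k)
  · obtain ⟨k, rfl⟩ : ∃ k : Node M, (k : ℤ) = i := ⟨⟨i, mem_nodes.2 hi⟩, rfl⟩
    simp only [extend_coe, hv.initial hq, toNode]

lemma IsExact.memW1_rpow (hq : 1 < q) (hv : IsExact (lap θ h M) q (toNode M u0) v)
    (hc : Continuous v) (i : ℤ) {T : ℝ} (hT : 0 < T) :
    MemW1 1 T (fun t => oddPow (extend (v t) i) q) := by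
  rcases node_cases M i with ⟨k, rfl⟩ | hz
  · simp only [extend_coe]
    have hq1 : 0 < q - 1 := by linarith
    have h1 : 1 < q / (q - 1) := by rw [lt_div_iff₀ hq1]; linarith
    have hck : Continuous fun t => v t k := (continuous_apply k).comp hc
    have hd : Continuous fun t => q / (q - 1) *
        |oddPow (v t k) (q - 1)| ^ (q / (q - 1) - 1) * -lap θ h M (v t) k :=
      (continuous_const.mul ((((continuous_oddPow hq1).comp hck).abs).rpow_const
        fun _ => Or.inr (by linarith))).mul (continuous_map_apply hc k).neg
    exact MemW1.of_hasDerivAt hT.le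
      ((continuous_oddPow (show 0 < q by linarith)).comp hck).continuousOn hd.continuousOn
      (fun t ht => hv.hasDerivAt_oddPow hq hc ht.1 k) 1
  · simp only [hz, oddPow_zero]
    exact memW1_zero hT.le 1

/-- The classical derivative exists almost everywhere by absolute continuity; it is the weak
derivative, and dissipation makes it square integrable. -/
lemma IsExact.memW1_half (h0 : 0 < θ) (h1 : θ < 1) (hh : 0 < h) (hq : 1 < q)
    (hv : IsExact (lap θ h M) q (toNode M u0) v) (hc : Continuous v)
    (hmax : ∀ t, v (max t 0) = v t) (i : ℤ) {T : ℝ} (hT : 0 < T) :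
    MemW1 2 T (fun t => oddPow (extend (v t) i) (q / 2)) ∧
    HasWeakDeriv T (fun t => oddPow (extend (v t) i) (q / 2))
      (fun t => extend (fun k => deriv (fun t => oddPow (v t k) (q / 2)) t) i) := by
  rcases node_cases M i with ⟨k, rfl⟩ | hz
  · simp only [extend_coe]
    obtain ⟨hac, hsq, -⟩ :=
      hv.integral_energy (isPSD_lap h0 h1 hh M) hq hc hmax le_rfl hT.le
    have hweak := HasWeakDeriv.of_absolutelyContinuous hT.le (hac k)
    refine ⟨⟨memLp_of_continuousOn ?_ 2, _, ?_, hweak⟩, hweak⟩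
    · exact ((continuous_oddPow (show 0 < q / 2 by linarith)).comp
        ((continuous_apply k).comp hc)).continuousOn
    · refine (memLp_two_iff_integrable_sq (measurable_deriv _).aestronglyMeasurable).2 ?_
      exact ((intervalIntegrable_iff_integrableOn_Ioc_of_le hT.le).1 (hsq k)).mono_set
        Ioo_subset_Ioc_self
  · simp only [hz, oddPow_zero]
    exact ⟨memW1_zero hT.le 2, hasWeakDeriv_zero hT.le⟩

/-- The chain rule for |v_i|^q, summed over the nodes, produces -q' h⟨Av, v⟩; it holds at every t >
0. -/
lemma IsExact.energy_identity (h0 : 0 < θ) (h1 : θ < 1) (hh : 0 < h) (hq : 1 < q)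
    (hv : IsExact (lap θ h M) q (toNode M u0) v) (hc : Continuous v) {t : ℝ} (ht : 0 < t) :
    DifferentiableAt ℝ (fun τ => lNorm h q (extend (v τ)) ^ q) t ∧
    1 / Real.conjExponent q * deriv (fun τ => lNorm h q (extend (v τ)) ^ q) t +
      xNorm θ h (extend (v t)) ^ 2 = 0 := by
  have hd : HasDerivAt (fun τ => lNorm h q (extend (v τ)) ^ q)
      (h * ∑ i, Real.conjExponent q * (v t i * -lap θ h M (v t) i)) t := by
    simp_rw [lNorm_rpow_extend hh (show 0 < q by linarith)]
    exact (HasDerivAt.fun_sum fun i _ => hv.hasDerivAt_abs_rpow hq hc ht i).const_mul h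
  refine ⟨hd.differentiableAt, ?_⟩
  have hq' : Real.conjExponent q ≠ 0 := (Real.HolderConjugate.conjExponent hq).symm.ne_zero
  have e : ∑ i, Real.conjExponent q * (v t i * -lap θ h M (v t) i) =
      -(Real.conjExponent q * dotProduct (lap θ h M (v t)) (v t)) := by
    rw [dotProduct, Finset.mul_sum, ← Finset.sum_neg_distrib]
    exact Finset.sum_congr rfl fun i _ => by ring
  rw [hd.deriv, sq_xNorm_extend h0 h1 hh, e]
  field_simp
  ring

lemma IsExact.energy_inequality (h0 : 0 < θ) (h1 : θ < 1) (hh : 0 < h) (hq : 1 < q)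
    (hv : IsExact (lap θ h M) q (toNode M u0) v) (hc : Continuous v)
    (hmax : ∀ t, v (max t 0) = v t) {g : ℝ → Node M → ℝ}
    (hg : g = fun τ k => deriv (fun t => oddPow (v t k) (q / 2)) τ) {s t : ℝ} (hs : 0 ≤ s)
    (hst : s ≤ t) :
    IntervalIntegrable (fun τ => lNorm h 2 (extend (g τ)) ^ 2) volume s t ∧
    4 / (q * Real.conjExponent q) * (∫ τ in s..t, lNorm h 2 (extend (g τ)) ^ 2) +
      1 / 2 * xNorm θ h (extend (v t)) ^ 2 ≤ 1 / 2 * xNorm θ h (extend (v s)) ^ 2 := by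
  obtain ⟨-, hsq, hle⟩ := hv.integral_energy (isPSD_lap h0 h1 hh M) hq hc hmax hs hst
  simp_rw [sq_lNorm_two_extend hh, hg, sq_xNorm_extend h0 h1 hh]
  constructor
  · have := IntervalIntegrable.sum Finset.univ fun i (_ : i ∈ Finset.univ) => hsq i
    simp only [Finset.sum_fn] at this
    exact this.const_mul h
  · rw [intervalIntegral.integral_const_mul]
    nlinarith [mul_le_mul_of_nonneg_left hle hh.le]

lemma IsExact.tendstoUniformlyOn (h0 : 0 < θ) (h1 : θ < 1) (hh : 0 < h) (hq : 1 < q)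
    (hv : IsExact (lap θ h M) q (toNode M u0) v) {u : ℝ → ℕ → ℤ → ℝ}
    (hu : ∀ dt : ℝ, 0 < dt → IsFDSolution θ h q M u0 dt (u dt)) (i : ℤ) {T : ℝ} (hT : 0 ≤ T) :
    TendstoUniformlyOn (fun dt t => interpolant dt (u dt) t i) (fun t => extend (v t) i)
      (𝓝[>] 0) (Icc 0 T) := by
  rw [Metric.tendstoUniformlyOn_iff]
  intro ε hε
  obtain ⟨δ, hδ, hle⟩ := hv.exists_delta_euler (isPSD_lap h0 h1 hh M) hq hT hε
  filter_upwards [Ioo_mem_nhdsGT hδ] with dt hdt t ht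
  rw [dist_comm, Real.dist_eq]
  rcases le_or_gt |i| (M : ℤ) with hi | hi
  · obtain ⟨k, rfl⟩ : ∃ k : Node M, (k : ℤ) = i := ⟨⟨i, mem_nodes.2 hi⟩, rfl⟩
    obtain ⟨he, h0'⟩ := (hu dt hdt.1).isEuler h0 h1 hdt.1
    rw [extend_coe]
    exact hle hdt.1 hdt.2 he h0' t ht k
  · rw [extend_of_lt _ hi, interpolant, (hu dt hdt.1).boundary _ i (Int.add_one_le_iff.2 hi),
      sub_zero, abs_zero]
    exact hε

end Lattice

end FracScheme

/-! ### The proposition on (SD) and the convergence of (FD) -/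

theorem mainTheorem4 (θ h q : ℝ) (M : ℕ) (u0 : ℤ → ℝ)
    (hθ0 : 0 < θ) (hθ1 : θ < 1) (hh : 0 < h) (hq : 1 < q) (hM : 1 ≤ M)
    (hu0 : ∀ i : ℤ, (M : ℤ) < |i| → u0 i = 0) :
    ∃ v : ℝ → ℤ → ℝ,
      -- existence and uniqueness on `[0, ∞)`
      FracScheme.IsSDSolution θ h q M u0 v ∧
      (∀ w : ℝ → ℤ → ℝ, FracScheme.IsSDSolution θ h q M u0 w → ∀ t : ℝ, 0 ≤ t → w t = v t) ∧
      (∀ t : ℝ, 0 ≤ t → v t ∈ FracScheme.discreteX θ h M) ∧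
      -- regularity
      (∀ (i : ℤ) (T : ℝ), 0 < T →
        FracScheme.MemW1 1 T (fun t => FracScheme.oddPow (v t i) (q - 1)) ∧
        FracScheme.MemW1 1 T (fun t => FracScheme.oddPow (v t i) q) ∧
        FracScheme.MemW1 2 T (fun t => FracScheme.oddPow (v t i) (q / 2))) ∧
      -- energy identity
      (∀ᵐ t ∂(volume.restrict (Ioi (0 : ℝ))),
        DifferentiableAt ℝ (fun τ => FracScheme.lNorm h q (v τ) ^ q) t ∧
        1 / Real.conjExponent q * deriv (fun τ => FracScheme.lNorm h q (v τ) ^ q) t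
          + FracScheme.xNorm θ h (v t) ^ 2 = 0) ∧
      -- energy inequality, where `g τ i` is the weak derivative of `v_i ^ (q / 2)` at time `τ`
      (∃ g : ℝ → ℤ → ℝ,
        (∀ (i : ℤ) (T : ℝ), 0 < T →
          FracScheme.HasWeakDeriv T (fun t => FracScheme.oddPow (v t i) (q / 2))
            (fun t => g t i)) ∧
        ∀ s t : ℝ, 0 ≤ s → s < t →
          IntervalIntegrable (fun τ => FracScheme.lNorm h 2 (g τ) ^ 2) volume s t ∧
          (∀ᵐ τ ∂(volume.restrict (Ioc s t)), Summable fun i : ℤ => h * |g τ i| ^ (2 : ℝ)) ∧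
          4 / (q * Real.conjExponent q) * (∫ τ in s..t, FracScheme.lNorm h 2 (g τ) ^ 2)
            + 1 / 2 * FracScheme.xNorm θ h (v t) ^ 2
            ≤ 1 / 2 * FracScheme.xNorm θ h (v s) ^ 2) ∧
      -- the fully discrete scheme is well posed, and its solutions converge as `dt → 0`
      (∀ dt : ℝ, 0 < dt → ∃! u : ℕ → ℤ → ℝ, FracScheme.IsFDSolution θ h q M u0 dt u) ∧
      (∀ u : ℝ → ℕ → ℤ → ℝ,
        (∀ dt : ℝ, 0 < dt → FracScheme.IsFDSolution θ h q M u0 dt (u dt)) →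
        ∀ (i : ℤ) (T : ℝ), 0 < T →
          TendstoUniformlyOn (fun dt t => FracScheme.interpolant dt (u dt) t i)
            (fun t => v t i) (𝓝[>] 0) (Icc 0 T)) := by
  have hA := FracScheme.isPSD_lap hθ0 hθ1 hh M
  obtain ⟨v, hv, hc, hmax⟩ := hA.exists_continuous_isExact hq (FracScheme.toNode M u0)
  have hsol := hv.isSDSolution hθ0 hθ1 hq hc
  refine ⟨fun t => FracScheme.extend (v t), hsol, fun w hw t ht => ?_,
    fun t _ => FracScheme.extend_mem_discreteX hθ0 hθ1 hh (v t),
    fun i T hT => ⟨hsol.sobolev i T hT, hv.memW1_rpow hq hc i hT,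
      (hv.memW1_half hθ0 hθ1 hh hq hc hmax i hT).1⟩,
    (ae_restrict_iff' measurableSet_Ioi).2 (Eventually.of_forall fun t ht =>
      hv.energy_identity hθ0 hθ1 hh hq hc ht),
    ⟨fun τ => FracScheme.extend fun k =>
      deriv (fun t => FracScheme.oddPow (v t k) (q / 2)) τ,
      fun i T hT => (hv.memW1_half hθ0 hθ1 hh hq hc hmax i hT).2, fun s t hs hst => ?_⟩,
    fun dt hdt => FracScheme.existsUnique_isFDSolution hθ0 hθ1 hh hq hdt,
    fun u hu i T hT => hv.tendstoUniformlyOn hθ0 hθ1 hh hq hu i hT.le⟩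
  · simp only
    -- Uniqueness on the nodes extends to all indices because w vanishes off them.
    rw [← (hw.isExact hθ0 hθ1 hq).unique hA hq hv ht, FracScheme.extend_toNode fun i hi =>
      hw.boundary i (Int.add_one_le_iff.2 hi) t ht]
  · obtain ⟨hint, hle⟩ := hv.energy_inequality hθ0 hθ1 hh hq hc hmax rfl hs hst.le
    exact ⟨hint, Eventually.of_forall fun τ => FracScheme.summable_lNorm_extend h two_pos _, hle⟩
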